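/- Let $(T,E)$ be a $3$-regular tree with distance function $d$, let $k$ be a field, and let $\Omega$ be a bipartite orientation of $(T,E)$ (every vertex is a sink or a source). Let $f_0=0$, $f_1=1$, $f_{i+1}=f_i+f_{i-1}$ be the Fibonacci numbers. Let $K_0(T)$ be the free abelian group with basis $s(x)$, $x\in T$. For $y\in T$ let $\sigma^y$ be the reflection of $K_0(T)$ with $(\sigma^ya)_x=a_x$ for $x\ne y$ and $(\sigma^ya)_y=-a_y+\sum_{\{x,y\}\in E}a_x$. Let $\Sigma^x$ (respectively $\underline\Sigma^x$) be the composition of all $\sigma^y$ with $d(x,y)$ even (respectively odd). For $x\in T$ put $s_0(x)=s(x)$, and for $\{x,y\}\in E$ put $r_0(x,y)=s(x)+s(y)$. Define recursively $s_{i+1}(x)=\underline\Sigma^xs_i(x)$, $r_{i+1}(x,y)=\underline\Sigma^xr_i(x,y)$ for even $i\ge 0$, and $s_{i+1}(x)=\Sigma^xs_i(x)$, $r_{i+1}(x,y)=\Sigma^xr_i(x,y)$ for odd $i$. If $x$ is a sink of $\Omega$ and $i$ is even, or $x$ is a source and $i$ is odd, let $P_i(x)$ be the indecomposable representation over $k$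 of the quiver $(T,E,\Omega)$ with dimension vector $s_i(x)$, and for $\{x,y\}\in E$ let $R_i(x,y)$ be the one with dimension vector $r_i(x,y)$. Let $t\ge 0$ and let $x_0,x_1,\dots,x_t$ be a path in the tree ($\{x_{i-1},x_i\}\in E$ for $1\le i\le t$, and $x_{i+1}\ne x_{i-1}$ for $0<i<t$) such that $x_0$ is a sink of $\Omega$. Then the modules $P_i(x_i)$ for $0\le i\le t$ and $R_i(x_i,x_{i-1})$ for $1\le i\le t$ exist and are unique up to isomorphism, and $P_t(x_t)$ has a filtration by subrepresentations $$F_0\subset F_1\subset\cdots\subset F_t=P_t(x_t)$$ with $F_i\cong P_i(x_i)$ for $0\le i\le t$ and $F_i/F_{i-1}\cong R_i(x_i,x_{i-1})$ for $1\le i\le t$. This categorifies the equality $f_{2t}=\sum_{i=1}^tf_{2i-1}$ in the following sense. For a representation $M$ let $M_-$ be the sum of the dimensions $\dim M_z$ over all sources $z$. Then $P_i(x_i)_-=f_{2i}$ for $0\le i\le t$ and $R_i(x_i,x_{i-1})_-=f_{2i-1}$ for $1\le i\le t$; moreover $P_t(x_t)_-=\sum_{i=1}^tR_i(x_i,x_{i-1})_-$,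 that is, $f_{2t}=\sum_{i=1}^tf_{2i-1}$. -/

import Mathlib

namespace FibQuiver

universe u v

section Vectors

variable {T : Type v} (G : SimpleGraph T) [G.LocallyFinite]

/-- The reflection `σ^y` of the free abelian group `K₀(T)` on the vertices: it replaces the
coordinate at `y` by `-a_y` plus the sum of the coordinates at the neighbours of `y`. -/
noncomputable def reflectAt (y : T) (a : T →₀ ℤ) : T →₀ ℤ :=
  a.update y (-a y + ∑ x ∈ G.neighborFinset y, a x)

theorem reflectAt_apply [DecidableEq T] (y z : T) (a : T →₀ ℤ) :
    reflectAt G y a z =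
      if z = y then -a y + ∑ x ∈ G.neighborFinset y, a x else a z := by
  classical
  simp only [reflectAt, Finsupp.update_apply]

open Classical in
/-- The composition of all the (pairwise commuting) reflections `σ^y` with `y ∈ A`, for a set `A`
of vertices without adjacent members. As no neighbour of a vertex of `A` is in `A`, each coordinate
in `A` is reflected once, using the unchanged coordinates of its neighbours; see
`foldr_reflectAt_eq_reflectSet`. -/
noncomputable def reflectSet (A : Set T) (a : T →₀ ℤ) : T →₀ ℤ :=
  Finsupp.ofSupportFinite
    (fun z => if z ∈ A then -a z + ∑ x ∈ G.neighborFinset z, a x else a z) <| by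
    refine (a.support ∪ a.support.biUnion fun x => G.neighborFinset x).finite_toSet.subset ?_
    intro z hz
    by_contra hcon
    simp only [Finset.coe_union, Finset.coe_biUnion, Set.mem_union, Set.mem_iUnion,
      Finset.mem_coe, Finsupp.mem_support_iff, SimpleGraph.mem_neighborFinset, not_or,
      not_exists, not_not] at hcon
    obtain ⟨h1, h2⟩ := hcon
    apply hz
    have h3 : ∑ x ∈ G.neighborFinset z, a x = 0 := by
      refine Finset.sum_eq_zero fun x hx => ?_
      by_contra hne
      exact h2 x hne ((G.mem_neighborFinset z x).1 hx).symm
    simp [h1, h3]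

open Classical in
theorem reflectSet_apply (A : Set T) (a : T →₀ ℤ) (z : T) :
    reflectSet G A a z =
      if z ∈ A then -a z + ∑ x ∈ G.neighborFinset z, a x else a z := rfl

/-- `reflectSet G A a` is what one gets from `a` by applying, in any order, the reflections at
the members of `A`, leaving out some that act trivially on `a`. -/
theorem foldr_reflectAt_eq_reflectSet (A : Set T)
    (hA : ∀ y ∈ A, ∀ z ∈ A, ¬ G.Adj y z) (a : T →₀ ℤ) (l : List T) (hl : l.Nodup)
    (hlA : ∀ y ∈ l, y ∈ A) (hall : ∀ y ∈ A, y ∉ l → reflectAt G y a = a) :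
    l.foldr (reflectAt G) a = reflectSet G A a := by
  classical
  have key : ∀ l : List T, l.Nodup → (∀ y ∈ l, y ∈ A) → ∀ z, l.foldr (reflectAt G) a z =
      if z ∈ l then -a z + ∑ x ∈ G.neighborFinset z, a x else a z := by
    intro l
    induction l with
    | nil => intro _ _ z; simp
    | cons y l ih =>
      intro hn hA' z
      have hn' := List.nodup_cons.1 hn
      have ih' := ih hn'.2 fun w hw => hA' w (List.mem_cons_of_mem _ hw)
      rw [List.foldr_cons, reflectAt_apply]
      by_cases hzy : z = y
      · subst hzy
        rw [if_pos rfl, if_pos List.mem_cons_self, ih', if_neg hn'.1]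
        congr 1
        refine Finset.sum_congr rfl fun x hx => ?_
        rw [ih', if_neg]
        intro hxl
        exact hA z (hA' z List.mem_cons_self) x (hA' x (List.mem_cons_of_mem _ hxl))
          ((G.mem_neighborFinset z x).1 hx)
      · rw [if_neg hzy, ih']
        simp [hzy]
  ext z
  rw [key l hl hlA, reflectSet_apply]
  by_cases hz : z ∈ l
  · rw [if_pos hz, if_pos (hlA z hz)]
  · rw [if_neg hz]
    split_ifs with hzA
    · have := DFunLike.congr_fun (hall z hzA hz) z
      rw [reflectAt_apply, if_pos rfl] at this
      exact this.symm
    · rfl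

/-- `Σ^x`: all reflections at vertices of even distance from `x`. -/
noncomputable def reflectEven (x : T) : (T →₀ ℤ) → (T →₀ ℤ) :=
  reflectSet G {y | Even (G.dist x y)}

/-- `\underline{Σ}^x`: all reflections at vertices of odd distance from `x`. -/
noncomputable def reflectOdd (x : T) : (T →₀ ℤ) → (T →₀ ℤ) :=
  reflectSet G {y | Odd (G.dist x y)}

/-- The Fibonacci vectors `s_t(x)`. -/
noncomputable def sVec (x : T) : ℕ → (T →₀ ℤ)
  | 0 => Finsupp.single x 1
  | t + 1 => if Even t then reflectOdd G x (sVec x t) else reflectEven G x (sVec x t)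

/-- The Fibonacci vectors `r_t(x,y)`, for neighbours `x`, `y`. -/
noncomputable def rVec (x y : T) : ℕ → (T →₀ ℤ)
  | 0 => Finsupp.single x 1 + Finsupp.single y 1
  | t + 1 => if Even t then reflectOdd G x (rVec x y t) else reflectEven G x (rVec x y t)

end Vectors

/-- `x 0, …, x t` is a path (later values of `x` play no role): consecutive vertices
are adjacent, and there is no backtracking. -/
def IsPath {T : Type v} (G : SimpleGraph T) (t : ℕ) (x : ℕ → T) : Prop :=
  (∀ i, i + 1 ≤ t → G.Adj (x i) (x (i + 1))) ∧ ∀ i, i + 2 ≤ t → x (i + 2) ≠ x i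

/-- An orientation of a simple graph: for every edge `{a, b}` exactly one of the arrows
`a → b`, `b → a` is chosen. -/
structure GraphOrientation {T : Type v} (G : SimpleGraph T) where
  arrow : T → T → Prop
  adj_iff : ∀ a b, G.Adj a b ↔ arrow a b ∨ arrow b a
  asymm : ∀ a b, arrow a b → ¬ arrow b a

namespace GraphOrientation

variable {T : Type v} {G : SimpleGraph T} (Ω : GraphOrientation G)

/-- No arrow starts at `z`. -/
def IsSink (z : T) : Prop := ∀ b, ¬ Ω.arrow z b

/-- No arrow ends at `z`. -/
def IsSource (z : T) : Prop := ∀ a, ¬ Ω.arrow a z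

/-- Every vertex is a sink or a source. -/
def IsBipartite : Prop := ∀ z, Ω.IsSink z ∨ Ω.IsSource z

/-- `Ω` is the bipartite orientation for which `z` is a sink if `t` is even and
a source if `t` is odd. -/
def IsOmega (z : T) (t : ℕ) : Prop :=
  Ω.IsBipartite ∧ (Even t → Ω.IsSink z) ∧ (Odd t → Ω.IsSource z)

end GraphOrientation

/-- Representations over `k` of the quiver given by the oriented graph `(G, Ω)`. -/
structure QuiverRep (k : Type u) [Field k] {T : Type v} {G : SimpleGraph T}
    (Ω : GraphOrientation G) where
  V : T → Type u
  [addCommGroup : ∀ z, AddCommGroup (V z)]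
  [module : ∀ z, Module k (V z)]
  map : ∀ {a b : T}, Ω.arrow a b → V a →ₗ[k] V b

namespace QuiverRep

attribute [instance] QuiverRep.addCommGroup QuiverRep.module

variable {k : Type u} [Field k] {T : Type v} {G : SimpleGraph T} {Ω : GraphOrientation G}

/-- Isomorphisms of representations. -/
structure Iso (M N : QuiverRep k Ω) where
  equiv : ∀ z, M.V z ≃ₗ[k] N.V z
  comm : ∀ {a b : T} (h : Ω.arrow a b) (w : M.V a),
    equiv b (M.map h w) = N.map h (equiv a w)

/-- Subrepresentations. -/
structure SubRep (M : QuiverRep k Ω) where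
  space : ∀ z, Submodule k (M.V z)
  map_mem : ∀ {a b : T} (h : Ω.arrow a b), ∀ w ∈ space a, M.map h w ∈ space b

namespace SubRep

variable {M : QuiverRep k Ω}

/-- A subrepresentation as a representation. -/
def toRep (A : SubRep M) : QuiverRep k Ω where
  V z := A.space z
  map h := (M.map h).restrict (A.map_mem h)

/-- The factor `B / A` of subrepresentations `A ⊆ B` of `M`. -/
def factor (A B : SubRep M) : QuiverRep k Ω where
  V z := B.space z ⧸ (A.space z).submoduleOf (B.space z)
  map h := Submodule.mapQ _ _ ((M.map h).restrict (B.map_mem h))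
    fun w hw => A.map_mem h (w : M.V _) hw

end SubRep

/-- `M` is nonzero, and whenever `M` is the direct sum of two subrepresentations, one of them
is zero. -/
def IsIndecomposable (M : QuiverRep k Ω) : Prop :=
  (∃ z, Nontrivial (M.V z)) ∧
    ∀ A B : SubRep M, (∀ z, IsCompl (A.space z) (B.space z)) →
      (∀ z, A.space z = ⊥) ∨ (∀ z, B.space z = ⊥)

/-- `M` has dimension vector `d` (in particular, it is finite-dimensional at each vertex). -/
def HasDimVector (M : QuiverRep k Ω) (d : T →₀ ℤ) : Prop :=
  ∀ z, Module.Finite k (M.V z) ∧ (Module.finrank k (M.V z) : ℤ) = d z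

/-- The total dimension of `M` at the sources of the quiver. -/
noncomputable def sourceDim (M : QuiverRep k Ω) : ℕ :=
  ∑ᶠ (z : T) (_ : Ω.IsSource z), Module.finrank k (M.V z)

/-- `M` is the Fibonacci module `P_t(x)`. -/
def IsP [G.LocallyFinite] (M : QuiverRep k Ω) (t : ℕ) (x : T) : Prop :=
  Ω.IsOmega x t ∧ M.IsIndecomposable ∧ M.HasDimVector (sVec G x t)

/-- `M` is the Fibonacci module `R_t(x,y)`. -/
def IsR [G.LocallyFinite] (M : QuiverRep k Ω) (t : ℕ) (x y : T) : Prop :=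
  Ω.IsOmega x t ∧ G.Adj x y ∧ M.IsIndecomposable ∧ M.HasDimVector (rVec G x y t)

/-- There is a representation with property `p`, and it is unique up to isomorphism. -/
def ExistsUniqueUpToIso (p : QuiverRep k Ω → Prop) : Prop :=
  (∃ M, p M) ∧ ∀ M N, p M → p N → Nonempty (Iso M N)

end QuiverRep

end FibQuiver

/-! The proof uses Bernstein–Gelfand–Ponomarev reflections. Reflection at all sources of a bipartite
orientation Ω leads to the opposite orientation: the spaces at the sinks are kept, and the space at
a source b is replaced by the cokernel of M_b → ⨁ M_a, where a runs through the neighbours of b.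
Since x is a sink or a source according to the parity of t, the operator leading from s_t(x) to
s_{t+1}(x), and from r_t(x,y) to r_{t+1}(x,y), is the reflection at all sources. So everything is
shown by induction on t, with Ω replaced by its opposite.

`ReflPair` records reflection as a relation, by exactness of 0 → M_b → ⨁ M_a → N_b → 0 at the
sources b; its maps `e` matter at the sinks only. Direct decompositions can be carried both ways
(`pullback`, `pushforward`), hence so can indecomposability. A finite-dimensional indecomposable can
be reflected in either direction unless it is concentrated at one of the reflected vertices, and the
nonzero coordinates of s_t and r_t at some sink exclude that. Thus existence and uniqueness
propagate from t = 0, where there is a simple module for s_0 and a module of total dimension two for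
r_0.

Reflection also preserves the short exact sequences at hand (`ReflPair.shortExact`). Therefore 0 →
P_t(y) → P_{t+1}(x) → R_{t+1}(x,y) → 0 follows from the explicit case t = 0, and composing the
inclusions along the path yields the filtration. The Fibonacci numbers come from the effect of a
reflection on the coordinate sums over sinks and over sources. -/

namespace FibQuiver

universe u v

/-! ### Bipartite orientations and the reflection at all sources. -/

namespace GraphOrientation

variable {T : Type v} {G : SimpleGraph T} {Ω : GraphOrientation G}

/-- The opposite orientation. -/
def op (Ω : GraphOrientation G) : GraphOrientation G where
  arrow a b := Ω.arrow b a
  adj_iff a b := by rw [Ω.adj_iff, or_comm]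
  asymm a b h := Ω.asymm b a h

theorem IsBipartite.op (hΩ : Ω.IsBipartite) : Ω.op.IsBipartite := fun z => (hΩ z).symm

theorem adj_of_arrow {a b : T} (h : Ω.arrow a b) : G.Adj a b := (Ω.adj_iff a b).2 (Or.inl h)

theorem IsSource.arrow {a b : T} (hb : Ω.IsSource b) (h : G.Adj b a) : Ω.arrow b a :=
  ((Ω.adj_iff b a).1 h).resolve_right (hb a)

theorem IsSink.arrow {a b : T} (hb : Ω.IsSink b) (h : G.Adj b a) : Ω.arrow a b :=
  ((Ω.adj_iff b a).1 h).resolve_left (hb a)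

theorem IsBipartite.isSink (hΩ : Ω.IsBipartite) {a b : T} (h : Ω.arrow b a) : Ω.IsSink a :=
  (hΩ a).resolve_right fun hs => hs b h

theorem IsBipartite.isSource (hΩ : Ω.IsBipartite) {a b : T} (h : Ω.arrow b a) : Ω.IsSource b :=
  (hΩ b).resolve_left fun hs => hs a h

theorem IsBipartite.isSink_of_adj (hΩ : Ω.IsBipartite) {a b : T} (hb : Ω.IsSource b)
    (h : G.Adj b a) : Ω.IsSink a := hΩ.isSink (hb.arrow h)

theorem IsBipartite.isSource_of_adj (hΩ : Ω.IsBipartite) {a b : T} (hb : Ω.IsSink b)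
    (h : G.Adj b a) : Ω.IsSource a := hΩ.isSource (hb.arrow h)

theorem IsSink.not_isSource [G.LocallyFinite] (hreg : G.IsRegularOfDegree 3) {z : T}
    (hz : Ω.IsSink z) : ¬ Ω.IsSource z := by
  intro hs
  have h : 0 < G.degree z := by rw [hreg z]; norm_num
  obtain ⟨w, hw⟩ := (G.degree_pos_iff_exists_adj z).1 h
  exact hs w (hz.arrow hw)

/-- Reversing the arrows exchanges sinks and sources, which amounts to shifting the parity of the
index. This drives all inductions on t. -/
theorem IsOmega.op {z : T} {t : ℕ} (h : Ω.IsOmega z (t + 1)) : Ω.op.IsOmega z t :=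
  ⟨h.1.op, fun ht => h.2.2 ht.add_one, fun ht => h.2.1 ht.add_one⟩

theorem IsOmega.succ_of_adj {x y : T} {t : ℕ} (h : Ω.IsOmega y t) (hxy : G.Adj y x) :
    Ω.IsOmega x (t + 1) :=
  ⟨h.1, fun ht => h.1.isSink_of_adj (h.2.2 (by grind)) hxy,
    fun ht => h.1.isSource_of_adj (h.2.1 (by grind)) hxy⟩

theorem IsBipartite.walk_parity (hΩ : Ω.IsBipartite) {x y : T} (p : G.Walk x y) :
    (Even p.length → (Ω.IsSink x → Ω.IsSink y) ∧ (Ω.IsSource x → Ω.IsSource y)) ∧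
    (Odd p.length → (Ω.IsSink x → Ω.IsSource y) ∧ (Ω.IsSource x → Ω.IsSink y)) := by
  induction p with
  | nil => simp
  | cons h p ih =>
    rw [SimpleGraph.Walk.length_cons, Nat.even_add_one, Nat.odd_add_one, Nat.not_even_iff_odd,
      Nat.not_odd_iff_even]
    exact ⟨fun hp => ⟨fun hx => (ih.2 hp).2 (hΩ.isSource_of_adj hx h),
      fun hx => (ih.2 hp).1 (hΩ.isSink_of_adj hx h)⟩,
      fun hp => ⟨fun hx => (ih.1 hp).2 (hΩ.isSource_of_adj hx h),
      fun hx => (ih.1 hp).1 (hΩ.isSink_of_adj hx h)⟩⟩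

variable [G.LocallyFinite]

/-- The composition of the reflections at all sources. -/
noncomputable def reflectSources (Ω : GraphOrientation G) : (T →₀ ℤ) → (T →₀ ℤ) :=
  reflectSet G {z | Ω.IsSource z}

theorem reflectSources_of_isSource {z : T} (hz : Ω.IsSource z) (d : T →₀ ℤ) :
    Ω.reflectSources d z = -d z + ∑ x ∈ G.neighborFinset z, d x := by
  rw [reflectSources, reflectSet_apply, if_pos (by exact hz)]

theorem reflectSources_of_isSink (hreg : G.IsRegularOfDegree 3) {z : T} (hz : Ω.IsSink z)
    (d : T →₀ ℤ) : Ω.reflectSources d z = d z := by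
  rw [reflectSources, reflectSet_apply, if_neg (by exact hz.not_isSource hreg)]

/-- Sinks and sources alternate along walks, so the parity of the distance from x decides which a
vertex is. The reflections attached to x thereby become one operator depending on Ω alone, common to
all base points. -/
theorem IsOmega.setOf_odd_dist (hG : G.Connected) (hreg : G.IsRegularOfDegree 3) {x : T} {t : ℕ}
    (h : Ω.IsOmega x t) (ht : Even t) : {y | Odd (G.dist x y)} = {z | Ω.IsSource z} := by
  ext y
  obtain ⟨p, hp⟩ := hG.exists_walk_length_eq_dist x y
  have hw := h.1.walk_parity p
  rw [hp] at hw
  have hx := h.2.1 ht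
  refine ⟨fun hy => (hw.2 hy).1 hx, fun hy => ?_⟩
  by_contra hn
  exact ((hw.1 (Nat.not_odd_iff_even.1 hn)).1 hx).not_isSource hreg hy

theorem IsOmega.setOf_even_dist (hG : G.Connected) (hreg : G.IsRegularOfDegree 3) {x : T} {t : ℕ}
    (h : Ω.IsOmega x t) (ht : Odd t) : {y | Even (G.dist x y)} = {z | Ω.IsSource z} := by
  ext y
  obtain ⟨p, hp⟩ := hG.exists_walk_length_eq_dist x y
  have hw := h.1.walk_parity p
  rw [hp] at hw
  have hx := h.2.2 ht
  refine ⟨fun hy => (hw.1 hy).2 hx, fun hy => ?_⟩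
  by_contra hn
  exact ((hw.2 (Nat.not_even_iff_odd.1 hn)).2 hx).not_isSource hreg hy

theorem IsOmega.sVec_succ (hG : G.Connected) (hreg : G.IsRegularOfDegree 3) {x : T} {t : ℕ}
    (h : Ω.IsOmega x t) : sVec G x (t + 1) = Ω.reflectSources (sVec G x t) := by
  rw [sVec, reflectOdd, reflectEven, reflectSources]
  split_ifs with ht
  · rw [h.setOf_odd_dist hG hreg ht]
  · rw [h.setOf_even_dist hG hreg (Nat.not_even_iff_odd.1 ht)]

theorem IsOmega.rVec_succ (hG : G.Connected) (hreg : G.IsRegularOfDegree 3) {x : T} (y : T)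
    {t : ℕ} (h : Ω.IsOmega x t) : rVec G x y (t + 1) = Ω.reflectSources (rVec G x y t) := by
  rw [rVec, reflectOdd, reflectEven, reflectSources]
  split_ifs with ht
  · rw [h.setOf_odd_dist hG hreg ht]
  · rw [h.setOf_even_dist hG hreg (Nat.not_even_iff_odd.1 ht)]

theorem reflectSources_add (d e : T →₀ ℤ) :
    Ω.reflectSources (d + e) = Ω.reflectSources d + Ω.reflectSources e := by
  ext z
  simp only [reflectSources, reflectSet_apply, Finsupp.add_apply, Finset.sum_add_distrib]
  split_ifs <;> ring

theorem reflectSources_single_of_isSource (hΩ : Ω.IsBipartite) (hreg : G.IsRegularOfDegree 3)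
    {z : T} (hz : Ω.IsSource z) (c : ℤ) :
    Ω.reflectSources (Finsupp.single z c) = Finsupp.single z (-c) := by
  classical
  ext w
  rcases hΩ w with hw | hw
  · rw [reflectSources_of_isSink hreg hw]
    have : z ≠ w := fun h => hw.not_isSource hreg (h ▸ hz)
    simp [this]
  · rw [reflectSources_of_isSource hw, Finset.sum_eq_zero]
    · simp [Finsupp.single_apply]
    · intro x hx
      rw [Finsupp.single_apply, if_neg]
      rintro rfl
      exact (hΩ.isSink_of_adj hw ((G.mem_neighborFinset _ _).1 hx)).not_isSource hreg hz

theorem reflectSources_single_of_isSink (hΩ : Ω.IsBipartite) (hreg : G.IsRegularOfDegree 3)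
    {z : T} (hz : Ω.IsSink z) (c : ℤ) : Ω.reflectSources (Finsupp.single z c) =
      Finsupp.single z c + ∑ b ∈ G.neighborFinset z, Finsupp.single b c := by
  classical
  ext w
  have key : ∑ b ∈ G.neighborFinset z, (Finsupp.single b c : T →₀ ℤ) w =
      if G.Adj z w then c else 0 := by
    simp [Finsupp.single_apply]
  rw [Finsupp.add_apply, Finsupp.finsetSum_apply, key]
  rcases hΩ w with hw | hw
  · rw [reflectSources_of_isSink hreg hw, if_neg, add_zero]
    exact fun h => hw.not_isSource hreg (hΩ.isSource_of_adj hz h)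
  · have : z ≠ w := fun h => hz.not_isSource hreg (h ▸ hw)
    rw [reflectSources_of_isSource hw]
    simp [Finsupp.single_apply, this, G.adj_comm]

end GraphOrientation

/-! ### Coordinate sums over sinks and sources, and Fibonacci numbers. -/

section Weight

variable {T : Type v}

open Classical in
/-- The sum of the coordinates at the vertices with property `p`. -/
noncomputable def weight (p : T → Prop) : (T →₀ ℤ) →+ ℤ :=
  Finsupp.liftAddHom fun z => if p z then AddMonoidHom.id ℤ else 0

open Classical in
theorem weight_single (p : T → Prop) (z : T) (c : ℤ) :
    weight p (Finsupp.single z c) = if p z then c else 0 := by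
  rw [weight, Finsupp.liftAddHom_apply_single]
  split_ifs <;> rfl

theorem exists_ne_zero_of_weight_ne_zero {p : T → Prop} {d : T →₀ ℤ} (h : weight p d ≠ 0) :
    ∃ z, p z ∧ d z ≠ 0 := by
  by_contra! hn
  apply h
  rw [weight, Finsupp.liftAddHom_apply, Finsupp.sum]
  refine Finset.sum_eq_zero fun z hz => ?_
  split_ifs with hp
  · exact hn z hp
  · rfl

variable {G : SimpleGraph T} [G.LocallyFinite] {Ω : GraphOrientation G}

theorem weight_isSink_reflectSources (hΩ : Ω.IsBipartite) (hreg : G.IsRegularOfDegree 3)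
    (d : T →₀ ℤ) : weight Ω.IsSink (Ω.reflectSources d) = weight Ω.IsSink d := by
  classical
  induction d using Finsupp.induction_linear with
  | zero =>
    have := Ω.reflectSources_add 0 0
    simp only [add_zero, left_eq_add] at this
    rw [this]
  | add f g hf hg => rw [Ω.reflectSources_add, map_add, hf, hg, map_add]
  | single z c =>
    rcases hΩ z with hz | hz
    · rw [Ω.reflectSources_single_of_isSink hΩ hreg hz, map_add, map_sum, Finset.sum_eq_zero,
        add_zero]
      intro b hb
      rw [weight_single, if_neg]
      exact fun h => h.not_isSource hreg
        (hΩ.isSource_of_adj hz ((G.mem_neighborFinset _ _).1 hb))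
    · rw [Ω.reflectSources_single_of_isSource hΩ hreg hz, weight_single, weight_single,
        if_neg fun h => h.not_isSource hreg hz, if_neg fun h => h.not_isSource hreg hz]

/-- Each sink contributes its coordinate to three neighbouring sources, whence the factor 3. -/
theorem weight_isSource_reflectSources (hΩ : Ω.IsBipartite) (hreg : G.IsRegularOfDegree 3)
    (d : T →₀ ℤ) : weight Ω.IsSource (Ω.reflectSources d) =
      3 * weight Ω.IsSink d - weight Ω.IsSource d := by
  classical
  induction d using Finsupp.induction_linear with
  | zero =>
    have := Ω.reflectSources_add 0 0
    simp only [add_zero, left_eq_add] at this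
    simp [this]
  | add f g hf hg => rw [Ω.reflectSources_add, map_add, hf, hg, map_add, map_add]; ring
  | single z c =>
    rcases hΩ z with hz | hz
    · have : ∀ b ∈ G.neighborFinset z, weight Ω.IsSource (Finsupp.single b c) = c := by
        intro b hb
        rw [weight_single, if_pos (hΩ.isSource_of_adj hz ((G.mem_neighborFinset _ _).1 hb))]
      rw [Ω.reflectSources_single_of_isSink hΩ hreg hz, map_add, map_sum, Finset.sum_congr rfl this,
        Finset.sum_const, G.card_neighborFinset_eq_degree, hreg z, weight_single, weight_single,
        if_pos hz, if_neg (hz.not_isSource hreg)]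
      simp
    · have hz' : ¬ Ω.IsSink z := fun h => h.not_isSource hreg hz
      rw [Ω.reflectSources_single_of_isSource hΩ hreg hz]
      simp [weight_single, hz, hz']

/-- Reflection followed by the exchange of sinks and sources takes the pair (source sum, sink sum)
from (a, b) to (b, 3b - a), which is the recursion for every second Fibonacci number. -/
theorem weight_sVec (hG : G.Connected) (hreg : G.IsRegularOfDegree 3) {x : T} {t : ℕ}
    (h : Ω.IsOmega x t) : weight Ω.IsSource (sVec G x t) = Nat.fib (2 * t) ∧
      weight Ω.IsSink (sVec G x t) = Nat.fib (2 * t + 2) := by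
  classical
  induction t generalizing Ω with
  | zero =>
    have hx := h.2.1 Even.zero
    simp [sVec, weight_single, hx, hx.not_isSource hreg]
  | succ t ih =>
    -- Reversal is an involution by definition, so the given orientation is the opposite of one to
    -- which the induction hypothesis applies.
    obtain ⟨Ω, rfl⟩ : ∃ Ω₀ : GraphOrientation G, Ω = Ω₀.op := ⟨Ω.op, rfl⟩
    have h' : Ω.IsOmega x t := h.op
    obtain ⟨h1, h2⟩ := ih h'
    rw [h'.sVec_succ hG hreg]
    have e1 : weight Ω.op.IsSource = weight Ω.IsSink := rfl
    have e2 : weight Ω.op.IsSink = weight Ω.IsSource := rfl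
    rw [e1, e2, weight_isSink_reflectSources h'.1 hreg, weight_isSource_reflectSources h'.1 hreg,
      h1, h2]
    have f1 : Nat.fib (2 * t + 2) = Nat.fib (2 * t) + Nat.fib (2 * t + 1) := Nat.fib_add_two
    have f2 : Nat.fib (2 * t + 3) = Nat.fib (2 * t + 1) + Nat.fib (2 * t + 2) := Nat.fib_add_two
    have f3 : Nat.fib (2 * t + 4) = Nat.fib (2 * t + 2) + Nat.fib (2 * t + 3) := Nat.fib_add_two
    rw [show 2 * (t + 1) = 2 * t + 2 by ring]
    exact ⟨rfl, by push_cast [f3, f2, f1]; ring⟩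

/-- The recursion is that of `weight_sVec`. The source sum is written as a difference of integers to
be right at t = 0 too, where it is 1, the Fibonacci number of index -1. -/
theorem weight_rVec (hG : G.Connected) (hreg : G.IsRegularOfDegree 3) {x y : T}
    (hxy : G.Adj x y) {t : ℕ} (h : Ω.IsOmega x t) :
    weight Ω.IsSource (rVec G x y t) = Nat.fib (2 * t + 1) - Nat.fib (2 * t) ∧
      weight Ω.IsSink (rVec G x y t) = Nat.fib (2 * t + 1) := by
  classical
  induction t generalizing Ω with
  | zero =>
    have hx := h.2.1 Even.zero
    have hy := h.1.isSource_of_adj hx hxy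
    have hy' : ¬ Ω.IsSink y := fun h => h.not_isSource hreg hy
    simp [rVec, weight_single, hx, hx.not_isSource hreg, hy, hy']
  | succ t ih =>
    obtain ⟨Ω, rfl⟩ : ∃ Ω₀ : GraphOrientation G, Ω = Ω₀.op := ⟨Ω.op, rfl⟩
    have h' : Ω.IsOmega x t := h.op
    obtain ⟨h1, h2⟩ := ih h'
    rw [h'.rVec_succ hG hreg]
    have e1 : weight Ω.op.IsSource = weight Ω.IsSink := rfl
    have e2 : weight Ω.op.IsSink = weight Ω.IsSource := rfl
    rw [e1, e2, weight_isSink_reflectSources h'.1 hreg, weight_isSource_reflectSources h'.1 hreg,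
      h1, h2]
    have f1 : Nat.fib (2 * t + 2) = Nat.fib (2 * t) + Nat.fib (2 * t + 1) := Nat.fib_add_two
    have f2 : Nat.fib (2 * t + 3) = Nat.fib (2 * t + 1) + Nat.fib (2 * t + 2) := Nat.fib_add_two
    rw [show 2 * (t + 1) = 2 * t + 2 by ring]
    exact ⟨by push_cast [f2, f1]; ring, by push_cast [f2, f1]; ring⟩

/-- Guarantees that a module with this dimension vector is not concentrated at a source, the one
obstruction to reflecting an indecomposable. -/
theorem exists_isSink_sVec_ne_zero (hG : G.Connected) (hreg : G.IsRegularOfDegree 3) {x : T}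
    {t : ℕ} (h : Ω.IsOmega x t) : ∃ a, Ω.IsSink a ∧ sVec G x t a ≠ 0 := by
  apply exists_ne_zero_of_weight_ne_zero
  rw [(weight_sVec hG hreg h).2]
  exact_mod_cast (Nat.fib_pos.2 (by omega)).ne'

theorem exists_isSink_rVec_ne_zero (hG : G.Connected) (hreg : G.IsRegularOfDegree 3) {x y : T}
    (hxy : G.Adj x y) {t : ℕ} (h : Ω.IsOmega x t) : ∃ a, Ω.IsSink a ∧ rVec G x y t a ≠ 0 := by
  apply exists_ne_zero_of_weight_ne_zero
  rw [(weight_rVec hG hreg hxy h).2]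
  exact_mod_cast (Nat.fib_pos.2 (by omega)).ne'

end Weight

/-! ### Incoming and outgoing maps at a vertex, and splitting off summands. -/

namespace QuiverRep

variable {k : Type u} [Field k] {T : Type v} {G : SimpleGraph T} {Ω : GraphOrientation G}

section TotalMaps

open Classical in
/-- The map of `M` along the arrow `a → b`, or zero if there is none. -/
noncomputable def tmap (M : QuiverRep k Ω) (a b : T) : M.V a →ₗ[k] M.V b :=
  if h : Ω.arrow a b then M.map h else 0

theorem tmap_of_arrow (M : QuiverRep k Ω) {a b : T} (h : Ω.arrow a b) : M.tmap a b = M.map h :=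
  dif_pos h

theorem SubRep.tmap_mem {M : QuiverRep k Ω} (A : SubRep M) (a b : T) {w : M.V a}
    (hw : w ∈ A.space a) : M.tmap a b w ∈ A.space b := by
  rw [tmap]
  split_ifs with h
  · exact A.map_mem h w hw
  · simp

/-- The map from the space at `b` to the product of the spaces at the neighbours. -/
noncomputable def out (M : QuiverRep k Ω) (b : T) :
    M.V b →ₗ[k] (∀ a : G.neighborSet b, M.V a) :=
  LinearMap.pi fun a => M.tmap b a

theorem out_apply (M : QuiverRep k Ω) (b : T) (w : M.V b) (a : G.neighborSet b) :
    M.out b w a = M.tmap b a w := rfl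

variable [G.LocallyFinite]

/-- The map from the product of the spaces at the neighbours to the space at `b`. -/
noncomputable def inn (M : QuiverRep k Ω) (b : T) :
    (∀ a : G.neighborSet b, M.V a) →ₗ[k] M.V b :=
  ∑ a : G.neighborSet b, (M.tmap a b) ∘ₗ LinearMap.proj a

theorem inn_apply (M : QuiverRep k Ω) (b : T) (f : ∀ a : G.neighborSet b, M.V a) :
    M.inn b f = ∑ a : G.neighborSet b, M.tmap a b (f a) := by
  simp [inn]

open Classical in
theorem inn_single (M : QuiverRep k Ω) (b : T) (a : G.neighborSet b) (w : M.V a) :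
    M.inn b (Pi.single a w) = M.tmap a b w := by
  rw [inn_apply, Finset.sum_eq_single a]
  · simp
  · intro c _ hc; simp [Pi.single_eq_of_ne hc]
  · simp

theorem SubRep.inn_mem {M : QuiverRep k Ω} (A : SubRep M) (b : T)
    {f : ∀ a : G.neighborSet b, M.V a} (hf : ∀ a : G.neighborSet b, f a ∈ A.space a) : M.inn b f ∈ A.space b := by
  rw [inn_apply]
  exact Submodule.sum_mem _ fun a _ => A.tmap_mem a b (hf a)

end TotalMaps

section Splitting

theorem subsingleton_of_update_top_eq_bot {V : T → Type u} [∀ z, AddCommGroup (V z)]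
    [∀ z, Module k (V z)] [DecidableEq T] {b : T} {K : Submodule k (V b)}
    (h : ∀ z, Function.update (fun z => (⊤ : Submodule k (V z))) b K z = ⊥) {z : T}
    (hz : z ≠ b) : Subsingleton (V z) := by
  have := h z
  rw [Function.update_of_ne hz] at this
  exact (Submodule.subsingleton_iff k).1 (subsingleton_of_bot_eq_top this.symm)

theorem isCompl_update {V : T → Type u} [∀ z, AddCommGroup (V z)]
    [∀ z, Module k (V z)] [DecidableEq T] {b : T} {K L : Submodule k (V b)} (h : IsCompl K L)
    (z : T) : IsCompl (Function.update (fun z => (⊥ : Submodule k (V z))) b K z)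
      (Function.update (fun z => (⊤ : Submodule k (V z))) b L z) := by
  by_cases hz : z = b
  · subst hz; simpa using h
  · simpa [Function.update_of_ne hz] using isCompl_bot_top

/-- An indecomposable representation whose maps from the source `b` have a common kernel is
concentrated at `b`. -/
theorem IsIndecomposable.subsingleton_of_not_injective_out {M : QuiverRep k Ω}
    (hM : M.IsIndecomposable) {b : T} (hb : Ω.IsSource b)
    (hinj : ¬ Function.Injective (M.out b)) {z : T} (hz : z ≠ b) : Subsingleton (M.V z) := by
  classical
  -- The kernel, placed at b alone, is a direct summand: the other summand is L at b and all of M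
  -- elsewhere, stable because no arrow ends at b.
  obtain ⟨L, hL⟩ := (LinearMap.ker (M.out b)).exists_isCompl
  let A : SubRep M :=
    { space := Function.update (fun z => ⊥) b (LinearMap.ker (M.out b))
      map_mem := by
        intro a c h w hw
        by_cases ha : a = b
        · subst ha
          rw [Function.update_self, LinearMap.mem_ker] at hw
          have := congr_fun hw ⟨c, GraphOrientation.adj_of_arrow h⟩
          rw [out_apply, tmap_of_arrow M h] at this
          rw [this]
          exact zero_mem _
        · rw [Function.update_of_ne ha, Submodule.mem_bot] at hw
          rw [hw, map_zero]
          exact zero_mem _ }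
  let B : SubRep M :=
    { space := Function.update (fun z => ⊤) b L
      map_mem := by
        intro a c h w hw
        have hc : c ≠ b := fun hc => hb a (hc ▸ h)
        rw [Function.update_of_ne hc]
        trivial }
  rcases hM.2 A B (isCompl_update hL) with h | h
  · have := h b
    simp only [A, Function.update_self] at this
    exact absurd (LinearMap.ker_eq_bot.1 this) hinj
  · exact subsingleton_of_update_top_eq_bot h hz

/-- An indecomposable representation whose maps to the sink `b` do not generate is
concentrated at `b`. -/
theorem IsIndecomposable.subsingleton_of_not_surjective_inn [G.LocallyFinite]
    {M : QuiverRep k Ω} (hM : M.IsIndecomposable) {b : T} (hb : Ω.IsSink b)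
    (hsurj : ¬ Function.Surjective (M.inn b)) {z : T} (hz : z ≠ b) : Subsingleton (M.V z) := by
  classical
  -- Dually, L placed at b alone is stable because no arrow starts at b, and it splits off from the
  -- image at b together with all of M elsewhere.
  obtain ⟨L, hL⟩ := (LinearMap.range (M.inn b)).exists_isCompl
  let A : SubRep M :=
    { space := Function.update (fun z => ⊥) b L
      map_mem := by
        intro a c h w hw
        have ha : a ≠ b := fun ha => hb c (ha ▸ h)
        rw [Function.update_of_ne ha, Submodule.mem_bot] at hw
        rw [hw, map_zero]
        exact zero_mem _ }
  let B : SubRep M :=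
    { space := Function.update (fun z => ⊤) b (LinearMap.range (M.inn b))
      map_mem := by
        intro a c h w hw
        by_cases hc : c = b
        · subst hc
          rw [Function.update_self]
          refine ⟨Pi.single ⟨a, (GraphOrientation.adj_of_arrow h).symm⟩ w, ?_⟩
          rw [inn_single, tmap_of_arrow M h]
        · rw [Function.update_of_ne hc]
          trivial }
  rcases hM.2 A B (isCompl_update hL.symm) with h | h
  · have := h b
    simp only [A, Function.update_self] at this
    rw [this] at hL
    exact absurd (LinearMap.range_eq_top.1 (by simpa using hL.sup_eq_top)) hsurj
  · exact subsingleton_of_update_top_eq_bot h hz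

theorem HasDimVector.subsingleton_iff {M : QuiverRep k Ω} {d : T →₀ ℤ} (h : M.HasDimVector d)
    {z : T} : Subsingleton (M.V z) ↔ d z = 0 := by
  have := (h z).1
  rw [← (h z).2, ← Module.finrank_zero_iff (R := k)]
  simp

theorem HasDimVector.injective_out {M : QuiverRep k Ω} {d : T →₀ ℤ} (h : M.HasDimVector d)
    (hM : M.IsIndecomposable) {a b : T} (ha : d a ≠ 0) (hab : a ≠ b) (hb : Ω.IsSource b) :
    Function.Injective (M.out b) := by
  by_contra hn
  exact ha (h.subsingleton_iff.1 (hM.subsingleton_of_not_injective_out hb hn hab))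

theorem HasDimVector.surjective_inn [G.LocallyFinite] {M : QuiverRep k Ω} {d : T →₀ ℤ}
    (h : M.HasDimVector d)
    (hM : M.IsIndecomposable) {a b : T} (ha : d a ≠ 0) (hab : a ≠ b) (hb : Ω.IsSink b) :
    Function.Surjective (M.inn b) := by
  by_contra hn
  exact ha (h.subsingleton_iff.1 (hM.subsingleton_of_not_surjective_inn hb hn hab))

end Splitting

/-! ### Reflection as a relation, and its effect on dimensions. -/

/-- `N` is obtained from `M` by reflection at all sources `b`: up to identification of the
spaces at the sinks, `0 → M_b → ⨁ M_a → N_b → 0` is exact, where `a` runs through the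
neighbours of `b`. -/
structure ReflPair [G.LocallyFinite] (M : QuiverRep k Ω) (N : QuiverRep k Ω.op) where
  e : ∀ z, M.V z →ₗ[k] N.V z
  bij : ∀ a, Ω.IsSink a → Function.Bijective (e a)
  inj : ∀ b, Ω.IsSource b → Function.Injective (M.out b)
  surj : ∀ b, Ω.IsSource b → Function.Surjective (N.inn b)
  exact : ∀ b, Ω.IsSource b → ∀ f : ∀ a : G.neighborSet b, M.V a,
    N.inn b (fun a : G.neighborSet b => e a (f a)) = 0 ↔ ∃ w, M.out b w = f

namespace ReflPair

variable [G.LocallyFinite] {M : QuiverRep k Ω} {N : QuiverRep k Ω.op}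

/-- The identification of the products of the spaces at the neighbours of a source. -/
noncomputable def piEquiv (P : ReflPair M N) (hΩ : Ω.IsBipartite) {b : T} (hb : Ω.IsSource b) :
    (∀ a : G.neighborSet b, M.V a) ≃ₗ[k] (∀ a : G.neighborSet b, N.V a) :=
  LinearEquiv.piCongrRight fun a : G.neighborSet b =>
    LinearEquiv.ofBijective (P.e a) (P.bij a (hΩ.isSink_of_adj hb a.2))

theorem piEquiv_apply (P : ReflPair M N) (hΩ : Ω.IsBipartite) {b : T} (hb : Ω.IsSource b)
    (f : ∀ a : G.neighborSet b, M.V a) : P.piEquiv hΩ hb f = fun a : G.neighborSet b => P.e a (f a) := rfl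

/-- Every element at a reflected vertex comes from the neighbours. -/
theorem exists_inn (P : ReflPair M N) (hΩ : Ω.IsBipartite) {b : T} (hb : Ω.IsSource b)
    (v : N.V b) : ∃ f : ∀ a : G.neighborSet b, M.V a, N.inn b (fun a : G.neighborSet b => P.e a (f a)) = v := by
  obtain ⟨g, rfl⟩ := P.surj b hb v
  obtain ⟨f, rfl⟩ := (P.piEquiv hΩ hb).surjective g
  exact ⟨f, rfl⟩

theorem finite_left (P : ReflPair M N) (hΩ : Ω.IsBipartite)
    (h : ∀ z, Module.Finite k (N.V z)) (z : T) : Module.Finite k (M.V z) := by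
  rcases hΩ z with hz | hz
  · exact Module.Finite.equiv (LinearEquiv.ofBijective _ (P.bij z hz)).symm
  · have : Module.Finite k (∀ a : G.neighborSet z, M.V a) :=
      Module.Finite.equiv (P.piEquiv hΩ hz).symm
    exact Module.Finite.of_injective _ (P.inj z hz)

theorem finite_right (P : ReflPair M N) (hΩ : Ω.IsBipartite)
    (h : ∀ z, Module.Finite k (M.V z)) (z : T) : Module.Finite k (N.V z) := by
  rcases hΩ z with hz | hz
  · exact Module.Finite.equiv (LinearEquiv.ofBijective _ (P.bij z hz))
  · have : Module.Finite k (∀ a : G.neighborSet z, N.V a) :=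
      Module.Finite.equiv (P.piEquiv hΩ hz)
    exact Module.Finite.of_surjective _ (P.surj z hz)

theorem finrank_isSink (P : ReflPair M N) {z : T} (hz : Ω.IsSink z) :
    Module.finrank k (M.V z) = Module.finrank k (N.V z) :=
  (LinearEquiv.ofBijective _ (P.bij z hz)).finrank_eq

theorem finrank_isSource (P : ReflPair M N) (hΩ : Ω.IsBipartite)
    (h : ∀ z, Module.Finite k (M.V z)) {z : T} (hz : Ω.IsSource z) :
    Module.finrank k (M.V z) + Module.finrank k (N.V z) =
      ∑ x ∈ G.neighborFinset z, Module.finrank k (M.V x) := by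
  let q : (∀ a : G.neighborSet z, M.V a) →ₗ[k] N.V z :=
    N.inn z ∘ₗ (P.piEquiv hΩ hz).toLinearMap
  have hq : Function.Surjective q := (P.surj z hz).comp (P.piEquiv hΩ hz).surjective
  have hker : LinearMap.ker q = LinearMap.range (M.out z) := by
    ext f
    exact P.exact z hz f
  have := q.finrank_range_add_finrank_ker
  rw [LinearMap.range_eq_top.2 hq, finrank_top, hker,
    LinearMap.finrank_range_of_inj (P.inj z hz), Module.finrank_pi_fintype] at this
  rw [add_comm, this]
  exact (Finset.sum_subtype (G.neighborFinset z) (fun x => by simp)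
    fun x => Module.finrank k (M.V x)).symm

theorem hasDimVector_right (P : ReflPair M N) (hΩ : Ω.IsBipartite)
    (hreg : G.IsRegularOfDegree 3) {d : T →₀ ℤ}
    (h : M.HasDimVector d) : N.HasDimVector (Ω.reflectSources d) := by
  intro z
  refine ⟨P.finite_right hΩ (fun z => (h z).1) z, ?_⟩
  rcases hΩ z with hz | hz
  · rw [Ω.reflectSources_of_isSink hreg hz, ← (h z).2, P.finrank_isSink hz]
  · have := P.finrank_isSource hΩ (fun z => (h z).1) hz
    rw [Ω.reflectSources_of_isSource hz, Finset.sum_congr rfl fun x _ => (h x).2.symm,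
      ← Nat.cast_sum, ← this, ← (h z).2]
    push_cast
    ring

theorem hasDimVector_left (P : ReflPair M N) (hΩ : Ω.IsBipartite)
    (hreg : G.IsRegularOfDegree 3) {d : T →₀ ℤ}
    (h : N.HasDimVector (Ω.reflectSources d)) : M.HasDimVector d := by
  have hfin := P.finite_left hΩ fun z => (h z).1
  -- The sinks come first: the dimension count at a source needs the dimensions at its neighbours.
  have hsink : ∀ z, Ω.IsSink z → (Module.finrank k (M.V z) : ℤ) = d z := by
    intro z hz
    rw [← Ω.reflectSources_of_isSink hreg hz, ← (h z).2, P.finrank_isSink hz]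
  intro z
  refine ⟨hfin z, ?_⟩
  rcases hΩ z with hz | hz
  · exact hsink z hz
  · have h1 := P.finrank_isSource hΩ hfin hz
    have h2 := (h z).2
    rw [Ω.reflectSources_of_isSource hz, Finset.sum_congr rfl fun x hx =>
      (hsink x (hΩ.isSink_of_adj hz ((G.mem_neighborFinset _ _).1 hx))).symm,
      ← Nat.cast_sum, ← h1] at h2
    push_cast at h2
    linarith

end ReflPair

end QuiverRep

/-! ### Transport of direct decompositions and of indecomposability. -/

theorem isCompl_of_forall {R V : Type*} [Ring R] [AddCommGroup V] [Module R V]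
    {K L : Submodule R V} (h1 : ∀ w ∈ K, w ∈ L → w = 0)
    (h2 : ∀ w, ∃ u ∈ K, ∃ v ∈ L, u + v = w) : IsCompl K L := by
  refine ⟨Submodule.disjoint_def.2 h1, codisjoint_iff.2 (eq_top_iff.2 fun w _ => ?_)⟩
  obtain ⟨u, hu, v, hv, rfl⟩ := h2 w
  exact Submodule.add_mem_sup hu hv

theorem exists_add_eq_of_isCompl {R V : Type*} [Ring R] [AddCommGroup V] [Module R V]
    {K L : Submodule R V} (h : IsCompl K L) (w : V) : ∃ u ∈ K, ∃ v ∈ L, u + v = w :=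
  Submodule.mem_sup.1 (h.sup_eq_top ▸ Submodule.mem_top)

theorem eq_zero_of_isCompl {R V : Type*} [Ring R] [AddCommGroup V] [Module R V]
    {K L : Submodule R V} (h : IsCompl K L) {w : V} (h1 : w ∈ K) (h2 : w ∈ L) : w = 0 :=
  Submodule.disjoint_def.1 h.disjoint w h1 h2

namespace QuiverRep

variable {k : Type u} [Field k] {T : Type v} {G : SimpleGraph T} {Ω : GraphOrientation G}

theorem tmap_of_isSink (M : QuiverRep k Ω) {a : T} (ha : Ω.IsSink a) (b : T) :
    M.tmap a b = 0 := dif_neg (ha b)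

variable [G.LocallyFinite]

namespace ReflPair

variable {M : QuiverRep k Ω} {N : QuiverRep k Ω.op}

/-- The subrepresentation of `M` corresponding to one of its reflection. -/
def pullback (P : ReflPair M N) (hΩ : Ω.IsBipartite) (A : SubRep N) : SubRep M where
  space z :=
    -- At a sink the second condition is automatic; at a source it alone decides.
    { carrier := {w | (Ω.IsSink z → P.e z w ∈ A.space z) ∧
        ∀ a, P.e a (M.tmap z a w) ∈ A.space a}
      zero_mem' := by simp
      add_mem' := by
        intro v w hv hw
        refine ⟨fun hz => ?_, fun a => ?_⟩
        · rw [map_add]; exact add_mem (hv.1 hz) (hw.1 hz)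
        · rw [map_add, map_add]; exact add_mem (hv.2 a) (hw.2 a)
      smul_mem' := by
        intro c w hw
        refine ⟨fun hz => ?_, fun a => ?_⟩
        · rw [map_smul]; exact Submodule.smul_mem _ _ (hw.1 hz)
        · rw [map_smul, map_smul]; exact Submodule.smul_mem _ _ (hw.2 a) }
  map_mem := by
    intro a b h w hw
    refine ⟨fun _ => ?_, fun c => ?_⟩
    · rw [← tmap_of_arrow M h]
      exact hw.2 b
    · rw [tmap_of_isSink M (hΩ.isSink h)]
      simp

theorem mem_pullback_of_isSink (P : ReflPair M N) (hΩ : Ω.IsBipartite) {A : SubRep N} {z : T}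
    (hz : Ω.IsSink z) {w : M.V z} : w ∈ (P.pullback hΩ A).space z ↔ P.e z w ∈ A.space z := by
  refine ⟨fun h => h.1 hz, fun h => ⟨fun _ => h, fun a => ?_⟩⟩
  rw [tmap_of_isSink M hz]
  simp

theorem mem_pullback_of_isSource (P : ReflPair M N) (hΩ : Ω.IsBipartite) {A : SubRep N} {z : T}
    (hz : Ω.IsSource z) {w : M.V z} : w ∈ (P.pullback hΩ A).space z ↔
      ∀ a : G.neighborSet z, P.e a (M.out z w a) ∈ A.space a := by
  refine ⟨fun h a => h.2 a, fun h => ⟨fun hs => ?_, fun a => ?_⟩⟩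
  -- A source that is also a sink has no arrows, so injectivity of `M.out z` forces w = 0.
  · have : M.out z w = 0 := by
      ext a
      rw [out_apply, tmap_of_isSink M hs]
      simp
    rw [P.inj z hz (this.trans (map_zero _).symm)]
    simp
  · by_cases ha : G.Adj z a
    · exact h ⟨a, ha⟩
    · rw [tmap, dif_neg fun h => ha (GraphOrientation.adj_of_arrow h)]
      simp

/-- At a source, split the components of `M.out z w` along A and B at the neighbours. The images of
the two parts in N_z lie in A and B and have sum zero, so both vanish, and by exactness both parts
come from M_z. -/
theorem isCompl_pullback (P : ReflPair M N) (hΩ : Ω.IsBipartite) {A B : SubRep N}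
    (h : ∀ z, IsCompl (A.space z) (B.space z)) (z : T) :
    IsCompl ((P.pullback hΩ A).space z) ((P.pullback hΩ B).space z) := by
  rcases hΩ z with hz | hz
  · refine isCompl_of_forall (fun w h1 h2 => ?_) (fun w => ?_)
    · rw [P.mem_pullback_of_isSink hΩ hz] at h1 h2
      exact (P.bij z hz).1 ((eq_zero_of_isCompl (h z) h1 h2).trans (map_zero _).symm)
    · obtain ⟨u, hu, v, hv, huv⟩ := exists_add_eq_of_isCompl (h z) (P.e z w)
      obtain ⟨u, rfl⟩ := (P.bij z hz).2 u
      obtain ⟨v, rfl⟩ := (P.bij z hz).2 v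
      rw [← map_add] at huv
      exact ⟨u, (P.mem_pullback_of_isSink hΩ hz).2 hu, v,
        (P.mem_pullback_of_isSink hΩ hz).2 hv, (P.bij z hz).1 huv⟩
  · refine isCompl_of_forall (fun w h1 h2 => ?_) (fun w => ?_)
    · rw [P.mem_pullback_of_isSource hΩ hz] at h1 h2
      apply P.inj z hz
      rw [map_zero]
      ext a
      exact (P.bij a (hΩ.isSink_of_adj hz a.2)).1
        ((eq_zero_of_isCompl (h a) (h1 a) (h2 a)).trans (map_zero _).symm)
    · choose f hf g hg hfg using fun a : G.neighborSet z =>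
        exists_add_eq_of_isCompl (h a) (P.e a (M.out z w a))
      obtain ⟨f, rfl⟩ := (P.piEquiv hΩ hz).surjective f
      obtain ⟨g, rfl⟩ := (P.piEquiv hΩ hz).surjective g
      have hw := (P.exact z hz _).2 ⟨w, rfl⟩
      have hsum : N.inn z (P.piEquiv hΩ hz f) + N.inn z (P.piEquiv hΩ hz g) = 0 := by
        rw [← map_add, ← hw]
        congr 1
        ext a
        exact hfg a
      have hf0 : N.inn z (P.piEquiv hΩ hz f) = 0 := by
        refine eq_zero_of_isCompl (h z) (A.inn_mem z hf) ?_
        rw [eq_neg_of_add_eq_zero_left hsum]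
        exact neg_mem (B.inn_mem z hg)
      have hg0 : N.inn z (P.piEquiv hΩ hz g) = 0 := by rwa [hf0, zero_add] at hsum
      obtain ⟨u, rfl⟩ := (P.exact z hz f).1 hf0
      obtain ⟨v, rfl⟩ := (P.exact z hz g).1 hg0
      refine ⟨u, (P.mem_pullback_of_isSource hΩ hz).2 hf, v,
        (P.mem_pullback_of_isSource hΩ hz).2 hg, P.inj z hz ?_⟩
      rw [map_add]
      apply (P.piEquiv hΩ hz).injective
      rw [map_add]
      ext a
      exact hfg a

/-- If A vanishes at the sinks, its complement B is everything there. As N at a source is generated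
by its neighbours, B is everything at the sources as well. -/
theorem eq_bot_of_pullback_eq_bot (P : ReflPair M N) (hΩ : Ω.IsBipartite) {A B : SubRep N}
    (h : ∀ z, IsCompl (A.space z) (B.space z)) (hA : ∀ z, (P.pullback hΩ A).space z = ⊥) (z : T) :
    A.space z = ⊥ := by
  have hsink : ∀ z, Ω.IsSink z → A.space z = ⊥ := by
    intro z hz
    rw [eq_bot_iff]
    intro v hv
    obtain ⟨w, rfl⟩ := (P.bij z hz).2 v
    have hw := (P.mem_pullback_of_isSink hΩ hz).2 hv
    rw [hA z, Submodule.mem_bot] at hw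
    simp [hw]
  rcases hΩ z with hz | hz
  · exact hsink z hz
  · rw [eq_bot_iff]
    intro v hv
    refine (Submodule.mem_bot k).2 (eq_zero_of_isCompl (h z) hv ?_)
    obtain ⟨f, rfl⟩ := P.surj z hz v
    refine B.inn_mem z fun a => ?_
    have := (h a).sup_eq_top
    rw [hsink a (hΩ.isSink_of_adj hz a.2), bot_sup_eq] at this
    rw [this]
    trivial

theorem isIndecomposable_right (P : ReflPair M N) (hΩ : Ω.IsBipartite)
    (hM : M.IsIndecomposable) : N.IsIndecomposable := by
  refine ⟨?_, fun A B h => ?_⟩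
  · by_contra! hN
    obtain ⟨z, hz⟩ := hM.1
    have hsink : ∀ a, Ω.IsSink a → Subsingleton (M.V a) := fun a ha =>
      (P.bij a ha).1.subsingleton
    rcases hΩ z with h | h
    · exact not_subsingleton _ (hsink z h)
    · have : ∀ a : G.neighborSet z, Subsingleton (M.V a) := fun a =>
        hsink a (hΩ.isSink_of_adj h a.2)
      exact not_subsingleton _ (P.inj z h).subsingleton
  · rcases hM.2 _ _ (P.isCompl_pullback hΩ h) with h' | h'
    · exact Or.inl (P.eq_bot_of_pullback_eq_bot hΩ h h')
    · exact Or.inr (P.eq_bot_of_pullback_eq_bot hΩ (fun z => (h z).symm) h')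

/-- The subrepresentation of the reflection corresponding to one of `M`. -/
def pushforward (P : ReflPair M N) (hΩ : Ω.IsBipartite) (A : SubRep M) : SubRep N where
  space z :=
    { carrier := {v | (Ω.IsSink z → ∃ w ∈ A.space z, P.e z w = v) ∧
        (Ω.IsSource z → ∃ f : ∀ a : G.neighborSet z, M.V a,
          (∀ a : G.neighborSet z, f a ∈ A.space a) ∧
            N.inn z (fun a : G.neighborSet z => P.e a (f a)) = v)}
      zero_mem' := by
        refine ⟨fun _ => ⟨0, zero_mem _, map_zero _⟩, fun _ => ⟨0, fun a => zero_mem _, ?_⟩⟩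
        rw [← map_zero (N.inn z)]
        congr 1
        ext a
        simp
      add_mem' := by
        intro v w hv hw
        refine ⟨fun hz => ?_, fun hz => ?_⟩
        · obtain ⟨x, hx, rfl⟩ := hv.1 hz
          obtain ⟨y, hy, rfl⟩ := hw.1 hz
          exact ⟨x + y, add_mem hx hy, map_add _ _ _⟩
        · obtain ⟨x, hx, rfl⟩ := hv.2 hz
          obtain ⟨y, hy, rfl⟩ := hw.2 hz
          refine ⟨x + y, fun a => add_mem (hx a) (hy a), ?_⟩
          rw [← map_add]
          congr 1
          ext a
          simp
      smul_mem' := by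
        intro c w hw
        refine ⟨fun hz => ?_, fun hz => ?_⟩
        · obtain ⟨y, hy, rfl⟩ := hw.1 hz
          exact ⟨c • y, Submodule.smul_mem _ _ hy, map_smul _ _ _⟩
        · obtain ⟨y, hy, rfl⟩ := hw.2 hz
          refine ⟨c • y, fun a => Submodule.smul_mem _ _ (hy a), ?_⟩
          rw [← map_smul]
          congr 1
          ext a
          simp }
  map_mem := by
    classical
    intro a b h v hv
    refine ⟨fun hb => absurd h (hb a), fun hb => ?_⟩
    obtain ⟨w, hw, rfl⟩ := hv.1 (hΩ.isSink h)
    let c : G.neighborSet b := ⟨a, GraphOrientation.adj_of_arrow h⟩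
    refine ⟨Pi.single c w, fun x => ?_, ?_⟩
    · by_cases hx : x = c
      · subst hx; simpa using hw
      · simp [Pi.single_eq_of_ne hx]
    · rw [← tmap_of_arrow N h, ← N.inn_single b c]
      congr 1
      ext x
      by_cases hx : x = c
      · subst hx; simp; rfl
      · simp [Pi.single_eq_of_ne hx]

theorem mem_pushforward_of_isSink (P : ReflPair M N) (hreg : G.IsRegularOfDegree 3)
    (hΩ : Ω.IsBipartite) {A : SubRep M} {z : T} (hz : Ω.IsSink z) {v : N.V z} :
    v ∈ (P.pushforward hΩ A).space z ↔ ∃ w ∈ A.space z, P.e z w = v :=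
  ⟨fun h => h.1 hz, fun h => ⟨fun _ => h, fun hs => absurd hs (hz.not_isSource hreg)⟩⟩

theorem mem_pushforward_of_isSource (P : ReflPair M N) (hreg : G.IsRegularOfDegree 3)
    (hΩ : Ω.IsBipartite) {A : SubRep M} {z : T} (hz : Ω.IsSource z) {v : N.V z} :
    v ∈ (P.pushforward hΩ A).space z ↔ ∃ f : ∀ a : G.neighborSet z, M.V a,
      (∀ a : G.neighborSet z, f a ∈ A.space a) ∧ N.inn z (P.piEquiv hΩ hz f) = v :=
  ⟨fun h => h.2 hz, fun h => ⟨fun hs => absurd hz (hs.not_isSource hreg), fun _ => h⟩⟩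

/-- For disjointness at a source, let f in A and g in B have the same image. Then f - g comes from
some w = u + v in M_z, with u in A and v in B, and f minus the image of u equals g plus the image of
v. This lies in both A and B, hence is zero, so f comes from u and its image vanishes. -/
theorem isCompl_pushforward (P : ReflPair M N) (hreg : G.IsRegularOfDegree 3)
    (hΩ : Ω.IsBipartite) {A B : SubRep M} (h : ∀ z, IsCompl (A.space z) (B.space z)) (z : T) :
    IsCompl ((P.pushforward hΩ A).space z) ((P.pushforward hΩ B).space z) := by
  rcases hΩ z with hz | hz
  · refine isCompl_of_forall (fun w h1 h2 => ?_) (fun w => ?_)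
    · obtain ⟨u, hu, rfl⟩ := (P.mem_pushforward_of_isSink hreg hΩ hz).1 h1
      obtain ⟨v, hv, huv⟩ := (P.mem_pushforward_of_isSink hreg hΩ hz).1 h2
      obtain rfl := (P.bij z hz).1 huv
      rw [eq_zero_of_isCompl (h z) hu hv, map_zero]
    · obtain ⟨w, rfl⟩ := (P.bij z hz).2 w
      obtain ⟨u, hu, v, hv, rfl⟩ := exists_add_eq_of_isCompl (h z) w
      exact ⟨_, (P.mem_pushforward_of_isSink hreg hΩ hz).2 ⟨u, hu, rfl⟩, _,
        (P.mem_pushforward_of_isSink hreg hΩ hz).2 ⟨v, hv, rfl⟩, (map_add _ _ _).symm⟩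
  · refine isCompl_of_forall (fun w h1 h2 => ?_) (fun w => ?_)
    · obtain ⟨f, hf, rfl⟩ := (P.mem_pushforward_of_isSource hreg hΩ hz).1 h1
      obtain ⟨g, hg, hfg⟩ := (P.mem_pushforward_of_isSource hreg hΩ hz).1 h2
      have hsub : N.inn z (P.piEquiv hΩ hz (f - g)) = 0 := by
        rw [map_sub, map_sub, hfg, sub_self]
      obtain ⟨w, hw⟩ := (P.exact z hz _).1 hsub
      obtain ⟨u, hu, v, hv, rfl⟩ := exists_add_eq_of_isCompl (h z) w
      have hfu : f = M.out z u := by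
        ext a
        have h1 : f a - M.out z u a ∈ A.space a := sub_mem (hf a) (A.tmap_mem z a hu)
        have h2 : f a - M.out z u a ∈ B.space a := by
          have : f a - M.out z u a = g a + M.out z v a := by
            have := congr_fun hw a
            rw [map_add, Pi.add_apply, Pi.sub_apply] at this
            rw [sub_eq_iff_eq_add]
            rw [eq_sub_iff_add_eq] at this
            rw [← this]
            abel
          rw [this]
          exact add_mem (hg a) (B.tmap_mem z a hv)
        exact sub_eq_zero.1 (eq_zero_of_isCompl (h a) h1 h2)
      exact (P.exact z hz f).2 ⟨u, hfu.symm⟩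
    · obtain ⟨l, rfl⟩ := P.exists_inn hΩ hz w
      choose f hf g hg hfg using fun a : G.neighborSet z =>
        exists_add_eq_of_isCompl (h a) (l a)
      refine ⟨_, (P.mem_pushforward_of_isSource hreg hΩ hz).2 ⟨f, hf, rfl⟩, _,
        (P.mem_pushforward_of_isSource hreg hΩ hz).2 ⟨g, hg, rfl⟩, ?_⟩
      rw [← map_add, ← map_add, ← P.piEquiv_apply hΩ hz]
      congr 2
      ext a
      exact hfg a

theorem eq_bot_of_pushforward_eq_bot (P : ReflPair M N) (hreg : G.IsRegularOfDegree 3)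
    (hΩ : Ω.IsBipartite) {A : SubRep M} (hA : ∀ z, (P.pushforward hΩ A).space z = ⊥) (z : T) :
    A.space z = ⊥ := by
  have hsink : ∀ z, Ω.IsSink z → A.space z = ⊥ := by
    intro z hz
    rw [eq_bot_iff]
    intro w hw
    have hv := (P.mem_pushforward_of_isSink hreg hΩ hz).2 ⟨w, hw, rfl⟩
    rw [hA z, Submodule.mem_bot] at hv
    exact (Submodule.mem_bot k).2 ((P.bij z hz).1 (hv.trans (map_zero _).symm))
  rcases hΩ z with hz | hz
  · exact hsink z hz
  · rw [eq_bot_iff]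
    intro w hw
    refine (Submodule.mem_bot k).2 (P.inj z hz ?_)
    rw [map_zero]
    ext a
    have := A.tmap_mem z a hw
    rwa [hsink a (hΩ.isSink_of_adj hz a.2), Submodule.mem_bot] at this

theorem isIndecomposable_left (P : ReflPair M N) (hreg : G.IsRegularOfDegree 3)
    (hΩ : Ω.IsBipartite) (hN : N.IsIndecomposable) : M.IsIndecomposable := by
  refine ⟨?_, fun A B h => ?_⟩
  · by_contra! hM
    obtain ⟨z, hz⟩ := hN.1
    rcases hΩ z with h | h
    · exact not_subsingleton _ (P.bij z h).2.subsingleton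
    · exact not_subsingleton _ ((P.surj z h).comp (P.piEquiv hΩ h).surjective).subsingleton
  · rcases hN.2 _ _ (P.isCompl_pushforward hreg hΩ h) with h' | h'
    · exact Or.inl (P.eq_bot_of_pushforward_eq_bot hreg hΩ h')
    · exact Or.inr (P.eq_bot_of_pushforward_eq_bot hreg hΩ h')

end ReflPair

end QuiverRep

/-! ### Existence of reflections in both directions. -/

namespace QuiverRep

variable {k : Type u} [Field k] {T : Type v} {G : SimpleGraph T} {Ω : GraphOrientation G}

theorem exists_linearEquiv_fin (k V : Type*) [Field k] [AddCommGroup V] [Module k V]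
    [Module.Finite k V] : ∃ n : ℕ, Nonempty (V ≃ₗ[k] (Fin n → k)) :=
  ⟨_, ⟨LinearEquiv.ofFinrankEq V (Fin (Module.finrank k V) → k) (by simp)⟩⟩

section Existence

variable [G.LocallyFinite]

/-- The space at a source is the cokernel of `M.out`. The product over neighbours may live in a
larger universe than the spaces of M, so every space is replaced by a coordinate space; this is
where finite dimension enters. -/
theorem exists_reflPair_right (hreg : G.IsRegularOfDegree 3) (hΩ : Ω.IsBipartite)
    (M : QuiverRep k Ω) (hfin : ∀ z, Module.Finite k (M.V z))
    (hinj : ∀ b, Ω.IsSource b → Function.Injective (M.out b)) :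
    ∃ N : QuiverRep k Ω.op, Nonempty (ReflPair M N) := by
  classical
  -- The maps e and ε are relevant at sinks and q at sources; elsewhere they are set to zero.
  have key : ∀ z, ∃ n : ℕ, ∃ (e : M.V z →ₗ[k] (Fin n → k)) (ε : (Fin n → k) →ₗ[k] M.V z)
      (q : (∀ a : G.neighborSet z, M.V a) →ₗ[k] (Fin n → k)),
      (Ω.IsSink z → Function.LeftInverse ε e ∧ Function.RightInverse ε e) ∧
      (Ω.IsSource z → Function.Surjective q ∧ ∀ f, q f = 0 ↔ ∃ w, M.out z w = f) := by
    intro z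
    rcases hΩ z with hz | hz
    · obtain ⟨n, ⟨e⟩⟩ := exists_linearEquiv_fin k (M.V z)
      exact ⟨n, e, e.symm, 0, fun _ => ⟨e.symm_apply_apply, e.apply_symm_apply⟩,
        fun h => absurd h (hz.not_isSource hreg)⟩
    · obtain ⟨n, ⟨e⟩⟩ := exists_linearEquiv_fin k
        ((∀ a : G.neighborSet z, M.V a) ⧸ LinearMap.range (M.out z))
      refine ⟨n, 0, 0, e.toLinearMap ∘ₗ Submodule.mkQ _,
        fun h => absurd hz (h.not_isSource hreg), fun _ => ⟨?_, fun f => ?_⟩⟩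
      · exact e.surjective.comp (Submodule.mkQ_surjective _)
      · simp
  choose n e ε q h1 h2 using key
  let N : QuiverRep k Ω.op :=
    { V := fun z => Fin (n z) → k
      map := fun {a b} h => q b ∘ₗ
        LinearMap.single k (fun c : G.neighborSet b => M.V c)
          ⟨a, GraphOrientation.adj_of_arrow (Ω := Ω) h⟩ ∘ₗ ε a }
  have hinn : ∀ b, Ω.IsSource b → ∀ f : ∀ a : G.neighborSet b, M.V a,
      N.inn b (fun a : G.neighborSet b => e a (f a)) = q b f := by
    intro b hb f
    have : f = ∑ a : G.neighborSet b, Pi.single a (f a) := (Finset.univ_sum_single f).symm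
    conv_rhs => rw [this, map_sum]
    rw [inn_apply]
    refine Finset.sum_congr rfl fun a _ => ?_
    rw [tmap_of_arrow N (show Ω.op.arrow a b from hb.arrow a.2)]
    change q b (Pi.single _ (ε a (e a (f a)))) = _
    rw [(h1 a (hΩ.isSink_of_adj hb a.2)).1]
  refine ⟨N, ⟨⟨e, fun a ha => ⟨(h1 a ha).1.injective, (h1 a ha).2.surjective⟩, hinj,
    fun b hb v => ?_, fun b hb f => ?_⟩⟩⟩
  · obtain ⟨f, hf⟩ := (h2 b hb).1 v
    exact ⟨_, (hinn b hb f).trans hf⟩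
  · rw [← (h2 b hb).2 f, ← hinn b hb f]

/-- Dual construction: the space at a source of Ω is the kernel of `N.inn`. -/
theorem exists_reflPair_left (hreg : G.IsRegularOfDegree 3) (hΩ : Ω.IsBipartite)
    (N : QuiverRep k Ω.op) (hfin : ∀ z, Module.Finite k (N.V z))
    (hsurj : ∀ b, Ω.IsSource b → Function.Surjective (N.inn b)) :
    ∃ M : QuiverRep k Ω, Nonempty (ReflPair M N) := by
  classical
  have key : ∀ z, ∃ n : ℕ, ∃ (e : N.V z →ₗ[k] (Fin n → k)) (ε : (Fin n → k) →ₗ[k] N.V z)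
      (i : (Fin n → k) →ₗ[k] (∀ a : G.neighborSet z, N.V a)),
      (Ω.IsSink z → Function.LeftInverse ε e ∧ Function.RightInverse ε e) ∧
      (Ω.IsSource z → Function.Injective i ∧ ∀ f, N.inn z f = 0 ↔ ∃ w, i w = f) := by
    intro z
    rcases hΩ z with hz | hz
    · obtain ⟨n, ⟨e⟩⟩ := exists_linearEquiv_fin k (N.V z)
      exact ⟨n, e, e.symm, 0, fun _ => ⟨e.symm_apply_apply, e.apply_symm_apply⟩,
        fun h => absurd h (hz.not_isSource hreg)⟩
    · obtain ⟨n, ⟨e⟩⟩ := exists_linearEquiv_fin k (LinearMap.ker (N.inn z))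
      refine ⟨n, 0, 0, Submodule.subtype _ ∘ₗ e.symm.toLinearMap,
        fun h => absurd hz (h.not_isSource hreg), fun _ => ⟨?_, fun f => ⟨fun hf => ?_, ?_⟩⟩⟩
      · exact (Submodule.subtype_injective _).comp e.symm.injective
      · exact ⟨e ⟨f, hf⟩, by simp⟩
      · rintro ⟨w, rfl⟩
        exact (e.symm w).2
  choose n e ε i h1 h2 using key
  let M : QuiverRep k Ω :=
    { V := fun z => Fin (n z) → k
      map := fun {b a} h => e a ∘ₗ
        LinearMap.proj (R := k) (φ := fun c : G.neighborSet b => N.V c)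
          ⟨a, GraphOrientation.adj_of_arrow (Ω := Ω) h⟩ ∘ₗ i b }
  have hout : ∀ b, Ω.IsSource b → ∀ w (a : G.neighborSet b), ε a (M.out b w a) = i b w a := by
    intro b hb w a
    rw [out_apply, tmap_of_arrow M (hb.arrow a.2)]
    exact (h1 a (hΩ.isSink_of_adj hb a.2)).1 _
  refine ⟨M, ⟨⟨ε, fun a ha => ⟨(h1 a ha).2.injective, (h1 a ha).1.surjective⟩,
    fun b hb v w hvw => ?_, hsurj, fun b hb f => ?_⟩⟩⟩
  · apply (h2 b hb).1
    ext a
    rw [← hout b hb, ← hout b hb, hvw]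
  · rw [(h2 b hb).2]
    refine exists_congr fun w => ⟨fun hw => ?_, fun hw => ?_⟩
    · refine funext fun a => (h1 a (hΩ.isSink_of_adj hb a.2)).2.injective ?_
      rw [hout b hb, hw]
    · ext a
      rw [← hout b hb, hw]

/-- The reflection of an indecomposable representation. -/
theorem exists_reflection (hreg : G.IsRegularOfDegree 3) (hΩ : Ω.IsBipartite)
    {M : QuiverRep k Ω} {d : T →₀ ℤ} (hd : ∃ a, Ω.IsSink a ∧ d a ≠ 0)
    (hM : M.IsIndecomposable) (hMd : M.HasDimVector d) :
    ∃ N : QuiverRep k Ω.op, Nonempty (ReflPair M N) ∧ N.IsIndecomposable ∧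
      N.HasDimVector (Ω.reflectSources d) := by
  obtain ⟨a, ha, had⟩ := hd
  obtain ⟨N, ⟨P⟩⟩ := exists_reflPair_right hreg hΩ M (fun z => (hMd z).1) fun b hb =>
    hMd.injective_out hM had (fun h => ha.not_isSource hreg (h ▸ hb)) hb
  exact ⟨N, ⟨P⟩, P.isIndecomposable_right hΩ hM, P.hasDimVector_right hΩ hreg hMd⟩

/-- An indecomposable representation is obtained by reflection from one of the expected
dimension vector. -/
theorem exists_reflection_eq (hreg : G.IsRegularOfDegree 3) (hΩ : Ω.IsBipartite)
    {N : QuiverRep k Ω.op} {d : T →₀ ℤ} (hd : ∃ a, Ω.IsSink a ∧ d a ≠ 0)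
    (hN : N.IsIndecomposable) (hNd : N.HasDimVector (Ω.reflectSources d)) :
    ∃ M : QuiverRep k Ω, Nonempty (ReflPair M N) ∧ M.IsIndecomposable ∧ M.HasDimVector d := by
  obtain ⟨a, ha, had⟩ := hd
  rw [← Ω.reflectSources_of_isSink hreg ha] at had
  obtain ⟨M, ⟨P⟩⟩ := exists_reflPair_left hreg hΩ N (fun z => (hNd z).1) fun b hb =>
    hNd.surjective_inn hN had (fun h => ha.not_isSource hreg (h ▸ hb)) hb
  exact ⟨M, ⟨P⟩, P.isIndecomposable_left hreg hΩ hN, P.hasDimVector_left hΩ hreg hNd⟩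

end Existence

/-! ### Homomorphisms and exact sequences under reflection. -/

/-- Homomorphisms of representations. -/
structure Hom (M N : QuiverRep k Ω) where
  app : ∀ z, M.V z →ₗ[k] N.V z
  comm : ∀ {a b : T} (h : Ω.arrow a b) (w : M.V a), app b (M.map h w) = N.map h (app a w)

namespace Hom

/-- The identity. -/
def id (M : QuiverRep k Ω) : Hom M M := ⟨fun _ => LinearMap.id, fun _ _ => rfl⟩

/-- The composition of two homomorphisms. -/
def comp {L M N : QuiverRep k Ω} (g : Hom M N) (f : Hom L M) : Hom L N :=
  ⟨fun z => g.app z ∘ₗ f.app z, fun h w => by simp [f.comm, g.comm]⟩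

variable {M N : QuiverRep k Ω}

theorem tmap_comm (f : Hom M N) (a b : T) (w : M.V a) :
    f.app b (M.tmap a b w) = N.tmap a b (f.app a w) := by
  by_cases h : Ω.arrow a b
  · rw [tmap_of_arrow M h, tmap_of_arrow N h, f.comm]
  · simp [tmap, h]

/-- The induced map on the products of the spaces at the neighbours of `b`. -/
def pi (f : Hom M N) (b : T) :
    (∀ a : G.neighborSet b, M.V a) →ₗ[k] (∀ a : G.neighborSet b, N.V a) :=
  LinearMap.pi fun a => f.app a ∘ₗ LinearMap.proj a

theorem pi_apply (f : Hom M N) (b : T) (g : ∀ a : G.neighborSet b, M.V a)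
    (a : G.neighborSet b) : f.pi b g a = f.app a (g a) := rfl

theorem out_comm (f : Hom M N) (b : T) (w : M.V b) :
    N.out b (f.app b w) = f.pi b (M.out b w) := by
  ext a
  exact (f.tmap_comm b a w).symm

theorem inn_comm [G.LocallyFinite] (f : Hom M N) (b : T) (g : ∀ a : G.neighborSet b, M.V a) :
    f.app b (M.inn b g) = N.inn b (f.pi b g) := by
  rw [inn_apply, inn_apply, map_sum]
  exact Finset.sum_congr rfl fun a _ => f.tmap_comm a b _

theorem pi_surjective (f : Hom M N) {b : T}
    (h : ∀ a : G.neighborSet b, Function.Surjective (f.app a)) :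
    Function.Surjective (f.pi b) := by
  intro g
  choose l hl using fun a : G.neighborSet b => h a (g a)
  exact ⟨l, funext hl⟩

theorem pi_injective (f : Hom M N) {b : T}
    (h : ∀ a : G.neighborSet b, Function.Injective (f.app a)) :
    Function.Injective (f.pi b) := by
  intro g l hgl
  exact funext fun a => h a (congr_fun hgl a)

/-- A bijective homomorphism is an isomorphism. -/
noncomputable def toIso (f : Hom M N) (h : ∀ z, Function.Bijective (f.app z)) : Iso M N :=
  ⟨fun z => LinearEquiv.ofBijective (f.app z) (h z), fun h w => f.comm h w⟩

end Hom

/-- Isomorphisms as homomorphisms. -/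
def Iso.toHom {M N : QuiverRep k Ω} (f : Iso M N) : Hom M N :=
  ⟨fun z => (f.equiv z).toLinearMap, fun h w => f.comm h w⟩

variable [G.LocallyFinite]

theorem exists_linearMap_comp_eq {P V W : Type*} [AddCommGroup P] [Module k P] [AddCommGroup V]
    [Module k V] [AddCommGroup W] [Module k W] (p : P →ₗ[k] V) (hp : Function.Surjective p)
    (q : P →ₗ[k] W) (h : ∀ x, p x = 0 → q x = 0) : ∃ g : V →ₗ[k] W, ∀ x, g (p x) = q x := by
  refine ⟨(LinearMap.ker p).liftQ q (fun x hx => h x hx) ∘ₗ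
    (p.quotKerEquivOfSurjective hp).symm.toLinearMap, fun x => ?_⟩
  have : (p.quotKerEquivOfSurjective hp).symm (p x) = Submodule.Quotient.mk x := by
    rw [LinearEquiv.symm_apply_eq]; rfl
  rw [LinearMap.comp_apply, LinearEquiv.coe_coe, this]
  exact Submodule.liftQ_apply _ _ _

/-- Homomorphisms extend to the reflections. -/
theorem ReflPair.exists_hom (hreg : G.IsRegularOfDegree 3) (hΩ : Ω.IsBipartite)
    {M M' : QuiverRep k Ω} {N N' : QuiverRep k Ω.op} (P : ReflPair M N) (P' : ReflPair M' N')
    (f : Hom M M') : ∃ g : Hom N N', (∀ a, Ω.IsSink a → ∀ w, g.app a (P.e a w) =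
      P'.e a (f.app a w)) ∧ ∀ b (hb : Ω.IsSource b) (l : ∀ a : G.neighborSet b, M.V a),
        g.app b (N.inn b (P.piEquiv hΩ hb l)) = N'.inn b (P'.piEquiv hΩ hb (f.pi b l)) := by
  classical
  have key : ∀ z, ∃ g : N.V z →ₗ[k] N'.V z, (Ω.IsSink z → ∀ w, g (P.e z w) =
      P'.e z (f.app z w)) ∧ ∀ (hb : Ω.IsSource z) (l : ∀ a : G.neighborSet z, M.V a),
        g (N.inn z (P.piEquiv hΩ hb l)) = N'.inn z (P'.piEquiv hΩ hb (f.pi z l)) := by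
    intro z
    rcases hΩ z with hz | hz
    · obtain ⟨g, hg⟩ := exists_linearMap_comp_eq (P.e z) (P.bij z hz).2 (P'.e z ∘ₗ f.app z) (by
        intro w hw
        rw [(P.bij z hz).1 (hw.trans (map_zero _).symm), map_zero])
      exact ⟨g, fun _ => hg, fun h => absurd h (hz.not_isSource hreg)⟩
    -- This is the map induced on cokernels: a tuple killed in N_z comes from M_z, so its image
    -- under f comes from M'_z and is killed in N'_z.
    · obtain ⟨g, hg⟩ := exists_linearMap_comp_eq (N.inn z ∘ₗ (P.piEquiv hΩ hz).toLinearMap)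
        ((P.surj z hz).comp (P.piEquiv hΩ hz).surjective)
        (N'.inn z ∘ₗ (P'.piEquiv hΩ hz).toLinearMap ∘ₗ f.pi z) (by
          intro l hl
          obtain ⟨w, rfl⟩ := (P.exact z hz l).1 hl
          exact (P'.exact z hz _).2 ⟨f.app z w, f.out_comm z w⟩)
      exact ⟨g, fun h => absurd hz (h.not_isSource hreg), fun _ => hg⟩
  choose g h1 h2 using key
  refine ⟨⟨g, fun {a b} h v => ?_⟩, h1, h2⟩
  have ha : Ω.IsSink a := hΩ.isSink h
  have hb : Ω.IsSource b := hΩ.isSource h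
  obtain ⟨w, rfl⟩ := (P.bij a ha).2 v
  let c : G.neighborSet b := ⟨a, GraphOrientation.adj_of_arrow h⟩
  -- A map along a single arrow is the total incoming map on tuples supported at one neighbour, so
  -- compatibility with arrows follows from compatibility with `inn`.
  have hsingle : ∀ {X : QuiverRep k Ω} {Y : QuiverRep k Ω.op} (Q : ReflPair X Y) (x : X.V a),
      Y.inn b (Q.piEquiv hΩ hb (Pi.single c x)) = Y.map h (Q.e a x) := by
    intro X Y Q x
    rw [← tmap_of_arrow Y h, ← Y.inn_single b c]
    congr 1
    rw [Q.piEquiv_apply]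
    ext y
    by_cases hy : y = c
    · subst hy; simp; rfl
    · simp [Pi.single_eq_of_ne hy]
  rw [← hsingle P w, h2 b hb, h1 a ha, ← hsingle P']
  congr 2
  ext y
  rw [Hom.pi_apply]
  by_cases hy : y = c
  · subst hy; simp; rfl
  · simp [Pi.single_eq_of_ne hy]

theorem ReflPair.hom_surjective (hΩ : Ω.IsBipartite)
    {M M' : QuiverRep k Ω} {N N' : QuiverRep k Ω.op} (P : ReflPair M N) (P' : ReflPair M' N')
    {f : Hom M M'} {g : Hom N N'} (h1 : ∀ a, Ω.IsSink a → ∀ w, g.app a (P.e a w) =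
      P'.e a (f.app a w)) (hf : ∀ z, Function.Surjective (f.app z)) (z : T) :
    Function.Surjective (g.app z) := by
  have hsink : ∀ z, Ω.IsSink z → Function.Surjective (g.app z) := by
    intro z hz v
    obtain ⟨w, rfl⟩ := (P'.bij z hz).2 v
    obtain ⟨u, rfl⟩ := hf z w
    exact ⟨_, h1 z hz u⟩
  rcases hΩ z with hz | hz
  · exact hsink z hz
  · intro v
    obtain ⟨l, rfl⟩ := P'.surj z hz v
    obtain ⟨m, rfl⟩ := g.pi_surjective (fun a => hsink a (hΩ.isSink_of_adj hz a.2)) l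
    exact ⟨_, g.inn_comm z m⟩

/-- Passing to cokernels need not preserve injectivity. The extra condition `hf'` says that an
element of M'_b whose components all come from M already comes from M_b. -/
theorem ReflPair.hom_injective (hΩ : Ω.IsBipartite)
    {M M' : QuiverRep k Ω} {N N' : QuiverRep k Ω.op} (P : ReflPair M N) (P' : ReflPair M' N')
    {f : Hom M M'} {g : Hom N N'} (h1 : ∀ a, Ω.IsSink a → ∀ w, g.app a (P.e a w) =
      P'.e a (f.app a w)) (h2 : ∀ b (hb : Ω.IsSource b) (l : ∀ a : G.neighborSet b, M.V a),
        g.app b (N.inn b (P.piEquiv hΩ hb l)) = N'.inn b (P'.piEquiv hΩ hb (f.pi b l)))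
    (hf : ∀ z, Function.Injective (f.app z))
    (hf' : ∀ b, Ω.IsSource b → ∀ w l, M'.out b w = f.pi b l → ∃ u, f.app b u = w) (z : T) :
    Function.Injective (g.app z) := by
  rw [injective_iff_map_eq_zero]
  intro v hv
  rcases hΩ z with hz | hz
  · obtain ⟨w, rfl⟩ := (P.bij z hz).2 v
    rw [h1 z hz] at hv
    have h := (P'.bij z hz).1 (hv.trans (map_zero _).symm)
    rw [hf z (h.trans (map_zero _).symm), map_zero]
  · obtain ⟨l, rfl⟩ := P.exists_inn hΩ hz v
    have h := h2 z hz l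
    rw [P.piEquiv_apply, hv] at h
    obtain ⟨w, hw⟩ := (P'.exact z hz _).1 h.symm
    obtain ⟨u, rfl⟩ := hf' z hz w l hw
    rw [f.out_comm] at hw
    exact (P.exact z hz l).2 ⟨u, f.pi_injective (fun a => hf a) hw⟩

theorem ReflPair.nonempty_iso (hreg : G.IsRegularOfDegree 3) (hΩ : Ω.IsBipartite)
    {M M' : QuiverRep k Ω} {N N' : QuiverRep k Ω.op} (P : ReflPair M N) (P' : ReflPair M' N')
    (f : Iso M M') : Nonempty (Iso N N') := by
  obtain ⟨g, h1, h2⟩ := P.exists_hom hreg hΩ P' f.toHom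
  exact ⟨g.toIso fun z => ⟨P.hom_injective hΩ P' h1 h2 (fun z => (f.equiv z).injective)
    (fun b _ w _ _ => (f.equiv b).surjective w) z,
    P.hom_surjective hΩ P' h1 (fun z => (f.equiv z).surjective) z⟩⟩

/-- There is a short exact sequence `0 → A → M → C → 0`. -/
def ShortExact (A M C : QuiverRep k Ω) : Prop :=
  ∃ (f : Hom A M) (g : Hom M C), (∀ z, Function.Injective (f.app z)) ∧
    (∀ z, Function.Surjective (g.app z)) ∧ ∀ z, Function.Exact (f.app z) (g.app z)

/-- Reflection preserves short exact sequences. -/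
theorem ReflPair.shortExact (hreg : G.IsRegularOfDegree 3) (hΩ : Ω.IsBipartite)
    {A M C : QuiverRep k Ω} {A' M' C' : QuiverRep k Ω.op} (PA : ReflPair A A')
    (PM : ReflPair M M') (PC : ReflPair C C') (h : ShortExact A M C) :
    ShortExact A' M' C' := by
  obtain ⟨f, g, hf, hg, hfg⟩ := h
  obtain ⟨f', f1, f2⟩ := PA.exists_hom hreg hΩ PM f
  obtain ⟨g', g1, g2⟩ := PM.exists_hom hreg hΩ PC g
  have hpi : ∀ b l, g.pi b (f.pi b l) = 0 := fun b l =>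
    funext fun a => (hfg a).apply_apply_eq_zero _
  refine ⟨f', g', PA.hom_injective hΩ PM f1 f2 hf fun b hb w l hw => ?_,
    PM.hom_surjective hΩ PC g1 hg, fun z => ?_⟩
  -- The condition `hf'` holds because the outgoing map of the quotient C at b is injective.
  · refine (hfg b w).1 (PC.inj b hb ?_)
    rw [g.out_comm, hw, hpi, map_zero]
  · rcases hΩ z with hz | hz
    · intro v
      obtain ⟨w, rfl⟩ := (PM.bij z hz).2 v
      rw [g1 z hz, map_eq_zero_iff _ (PC.bij z hz).1, hfg z w]
      constructor
      · rintro ⟨u, rfl⟩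
        exact ⟨_, f1 z hz u⟩
      · rintro ⟨u, hu⟩
        obtain ⟨u, rfl⟩ := (PA.bij z hz).2 u
        rw [f1 z hz] at hu
        exact ⟨u, (PM.bij z hz).1 hu⟩
    · intro v
      constructor
      · intro hv
        obtain ⟨l, rfl⟩ := PM.exists_inn hΩ hz v
        rw [← PM.piEquiv_apply hΩ hz, g2 z hz] at hv
        obtain ⟨c, hc⟩ := (PC.exact z hz _).1 hv
        -- Subtracting `M.out z w` from l does not change its image in M'_z, and it makes every
        -- component come from A.
        obtain ⟨w, rfl⟩ := hg z c
        rw [g.out_comm] at hc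
        have h0 : ∀ a : G.neighborSet z, ∃ u, f.app a u = (l - M.out z w) a := by
          intro a
          refine (hfg a _).1 ?_
          rw [← g.pi_apply, map_sub, hc, sub_self]
          rfl
        choose m hm using h0
        refine ⟨A'.inn z (PA.piEquiv hΩ hz m), ?_⟩
        have hm' : f.pi z m = l - M.out z w := funext hm
        have hw : M'.inn z (PM.piEquiv hΩ hz (M.out z w)) = 0 :=
          (PM.exact z hz _).2 ⟨w, rfl⟩
        rw [f2 z hz, hm', map_sub, map_sub, hw, sub_zero]
        rfl
      · rintro ⟨u, rfl⟩
        obtain ⟨l, rfl⟩ := PA.exists_inn hΩ hz u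
        rw [← PA.piEquiv_apply hΩ hz, f2 z hz, g2 z hz, hpi, map_zero, map_zero]

end QuiverRep

/-! ### From successive extensions to a filtration. -/

namespace QuiverRep

variable {k : Type u} [Field k] {T : Type v} {G : SimpleGraph T} {Ω : GraphOrientation G}

section Filtration

/-- The inverse isomorphism. -/
def Iso.symm {M N : QuiverRep k Ω} (f : Iso M N) : Iso N M :=
  ⟨fun z => (f.equiv z).symm, fun {a b} h w => by
    rw [LinearEquiv.symm_apply_eq, f.comm, LinearEquiv.apply_symm_apply]⟩

namespace Hom

variable {A B C X : QuiverRep k Ω}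

/-- The zero homomorphism. -/
def zero (A B : QuiverRep k Ω) : Hom A B := ⟨fun _ => 0, fun _ _ => by simp⟩

/-- The image of a homomorphism. -/
def range (f : Hom A B) : SubRep B where
  space z := LinearMap.range (f.app z)
  map_mem := by
    rintro a b h _ ⟨w, rfl⟩
    exact ⟨_, f.comm h w⟩

/-- A homomorphism as a homomorphism to its image. -/
def rangeRestrict (f : Hom A B) : Hom A f.range.toRep :=
  ⟨fun z => (f.app z).rangeRestrict, fun h w => Subtype.ext (f.comm h w)⟩

theorem nonempty_iso_range (f : Hom A B) (hf : ∀ z, Function.Injective (f.app z)) :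
    Nonempty (Iso f.range.toRep A) :=
  ⟨(f.rangeRestrict.toIso fun z => ⟨fun _ _ h => hf z (congr_arg Subtype.val h),
    LinearMap.surjective_rangeRestrict _⟩).symm⟩

/-- As ψ is injective, ψ(B)/ψ(f(A)) is B/f(A), which is C by exactness. -/
theorem nonempty_iso_factor (f : Hom A B) (g : Hom B C) (ψ : Hom B X)
    (hg : ∀ z, Function.Surjective (g.app z)) (hfg : ∀ z, Function.Exact (f.app z) (g.app z))
    (hψ : ∀ z, Function.Injective (ψ.app z)) :
    Nonempty (Iso ((ψ.comp f).range.factor ψ.range) C) := by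
  obtain ⟨p, hp, hpψ⟩ : ∃ p : ∀ z, B.V z →ₗ[k] ψ.range.space z,
      (∀ z, Function.Surjective (p z)) ∧ ∀ z x, (p z x : X.V z) = ψ.app z x :=
    ⟨fun z => (ψ.app z).rangeRestrict, fun z => LinearMap.surjective_rangeRestrict _,
      fun _ _ => rfl⟩
  have hker : ∀ z x, p z x ∈ ((ψ.comp f).range.space z).submoduleOf (ψ.range.space z) ↔
      g.app z x = 0 := by
    intro z x
    rw [hfg z x, Submodule.submoduleOf, Submodule.mem_comap, Submodule.subtype_apply, hpψ]
    constructor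
    · rintro ⟨y, hy⟩
      exact ⟨y, hψ z hy⟩
    · rintro ⟨y, rfl⟩
      exact ⟨y, rfl⟩
  have hρ : ∀ z, ∃ ρ : ψ.range.space z →ₗ[k] C.V z, ∀ x, ρ (p z x) = g.app z x := by
    intro z
    refine exists_linearMap_comp_eq _ (hp z) _ fun x hx => ?_
    rw [← hker, hx]
    exact zero_mem _
  choose ρ hρ using hρ
  let q : Hom ((ψ.comp f).range.factor ψ.range) C :=
    { app := fun z => Submodule.liftQ _ (ρ z) (by
        intro v hv
        obtain ⟨x, rfl⟩ := hp z v
        rw [LinearMap.mem_ker, hρ]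
        exact (hker z x).1 hv)
      comm := by
        intro a b h v
        obtain ⟨v, rfl⟩ := Submodule.Quotient.mk_surjective _ v
        obtain ⟨x, rfl⟩ := hp a v
        have h1 : (X.map h).restrict (ψ.range.map_mem h) (p a x) = p b (B.map h x) := by
          apply Subtype.ext
          rw [hpψ, ψ.comm, ← hpψ]
          rfl
        change ρ b ((X.map h).restrict (ψ.range.map_mem h) (p a x)) = C.map h (ρ a (p a x))
        rw [h1, hρ, hρ, g.comm] }
  refine ⟨q.toIso fun z => ⟨?_, fun c => ?_⟩⟩
  · rw [injective_iff_map_eq_zero]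
    intro v hv
    obtain ⟨v, rfl⟩ := Submodule.Quotient.mk_surjective _ v
    obtain ⟨x, rfl⟩ := hp z v
    exact (Submodule.Quotient.mk_eq_zero _).2 ((hker z x).2 ((hρ z x).symm.trans hv))
  · obtain ⟨x, rfl⟩ := hg z c
    exact ⟨Submodule.Quotient.mk (p z x), hρ z x⟩

end Hom

/-- A sequence of extensions gives a filtration. -/
theorem exists_filtration (P R : ℕ → QuiverRep k Ω) (t : ℕ)
    (h : ∀ i, i < t → ShortExact (P i) (P (i + 1)) (R (i + 1))) :
    ∃ F : ℕ → SubRep (P t),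
      (∀ i, i ≤ t → Nonempty (Iso (F i).toRep (P i))) ∧
      (∀ z, (F t).space z = ⊤) ∧
      (∀ i, i < t → ∀ z, (F i).space z ≤ (F (i + 1)).space z) ∧
      (∀ i, i < t → Nonempty (Iso ((F i).factor (F (i + 1))) (R (i + 1)))) := by
  -- Choosing a map for every index requires a value beyond t as well; there it is zero.
  have h' : ∀ i, ∃ f : Hom (P i) (P (i + 1)), i < t → ∃ g : Hom (P (i + 1)) (R (i + 1)),
      (∀ z, Function.Injective (f.app z)) ∧ (∀ z, Function.Surjective (g.app z)) ∧
        ∀ z, Function.Exact (f.app z) (g.app z) := by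
    intro i
    by_cases hi : i < t
    · obtain ⟨f, g, hfg⟩ := h i hi
      exact ⟨f, fun _ => ⟨g, hfg⟩⟩
    · exact ⟨Hom.zero _ _, fun h => absurd h hi⟩
  choose f hf using h'
  -- For i ≤ t this is the composite P_i → P_{i+1} → ⋯ → P_t, built downwards from the identity of
  -- P_t.
  let ψ : ∀ i, Hom (P i) (P t) := fun i => if hi : i ≤ t then
    Nat.decreasingInduction (motive := fun i _ => Hom (P i) (P t)) (fun i _ φ => φ.comp (f i))
      (Hom.id _) hi else Hom.zero _ _
  have hψt : ψ t = Hom.id _ := by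
    simp only [ψ, le_refl, dif_pos, Nat.decreasingInduction_self]
  have hψ : ∀ i, i < t → ψ i = (ψ (i + 1)).comp (f i) := by
    intro i hi
    simp only [ψ, hi.le, Nat.succ_le_of_lt hi, dif_pos]
    exact Nat.decreasingInduction_succ_left _ _ _ _
  have hinj : ∀ i, i ≤ t → ∀ z, Function.Injective ((ψ i).app z) := by
    intro i hi
    induction hi using Nat.decreasingInduction with
    | self => rw [hψt]; exact fun z => Function.injective_id
    | of_succ i hi ih =>
      obtain ⟨g, hfi, _⟩ := hf i hi
      rw [hψ i hi]
      exact fun z => (ih z).comp (hfi z)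
  refine ⟨fun i => (ψ i).range, fun i hi => (ψ i).nonempty_iso_range (hinj i hi), fun z => ?_,
    fun i hi z => ?_, fun i hi => ?_⟩
  · change LinearMap.range ((ψ t).app z) = ⊤
    rw [hψt]
    exact LinearMap.range_id
  · change LinearMap.range ((ψ i).app z) ≤ LinearMap.range ((ψ (i + 1)).app z)
    rw [hψ i hi]
    exact LinearMap.range_comp_le_range _ _
  · obtain ⟨g, _, hg, hfg⟩ := hf i hi
    change Nonempty (Iso ((ψ i).range.factor _) _)
    rw [hψ i hi]
    exact (f i).nonempty_iso_factor g (ψ (i + 1)) hg hfg (hinj (i + 1) hi)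

end Filtration

/-! ### Source dimensions; uniqueness of indecomposables with given dimension vector. -/

theorem HasDimVector.sourceDim_eq {M : QuiverRep k Ω} {d : T →₀ ℤ} (h : M.HasDimVector d) :
    (M.sourceDim : ℤ) = weight Ω.IsSource d := by
  classical
  have hs : (Function.support fun z => ∑ᶠ _ : Ω.IsSource z, Module.finrank k (M.V z)) ⊆
      d.support := by
    intro z hz
    rw [Function.mem_support, finsum_eq_if] at hz
    have := (h z).2
    simp only [Finset.mem_coe, Finsupp.mem_support_iff]
    grind
  rw [sourceDim, finsum_eq_sum_of_support_subset _ hs, weight, Finsupp.liftAddHom_apply,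
    Finsupp.sum, Nat.cast_sum]
  refine Finset.sum_congr rfl fun z _ => ?_
  rw [finsum_eq_if]
  split_ifs
  · exact (h z).2
  · rfl

theorem eq_bot_and_eq_top_or_of_isCompl {V : Type*} [AddCommGroup V] [Module k V]
    (h : Module.finrank k V = 1) (K L : Submodule k V) (hKL : IsCompl K L) :
    (K = ⊥ ∧ L = ⊤) ∨ (L = ⊥ ∧ K = ⊤) := by
  have : IsSimpleModule k V := isSimpleModule_iff_finrank_eq_one.2 h
  rcases eq_bot_or_eq_top K with hK | hK
  · subst hK
    exact Or.inl ⟨rfl, by simpa using hKL.sup_eq_top⟩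
  · subst hK
    exact Or.inr ⟨by simpa using hKL.inf_eq_bot, rfl⟩

theorem HasDimVector.nonempty_equiv {M N : QuiverRep k Ω} {d e : T →₀ ℤ} (hM : M.HasDimVector d)
    (hN : N.HasDimVector e) {z : T} (h : d z = e z) : Nonempty (M.V z ≃ₗ[k] N.V z) := by
  have := (hM z).1
  have := (hN z).1
  refine ⟨LinearEquiv.ofFinrankEq _ _ ?_⟩
  have := (hM z).2
  have := (hN z).2
  omega

/-- There is exactly one indecomposable representation of dimension vector `d`. -/
def UniqueIndecomposable (k : Type u) [Field k] (Ω : GraphOrientation G) (d : T →₀ ℤ) : Prop :=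
  ExistsUniqueUpToIso fun M : QuiverRep k Ω => M.IsIndecomposable ∧ M.HasDimVector d

theorem eq_bot_of_subsingleton {V : Type*} [AddCommGroup V] [Module k V] [Subsingleton V]
    (K : Submodule k V) : K = ⊥ := Subsingleton.elim _ _

theorem uniqueIndecomposable_single {x : T} (hx : Ω.IsSink x) :
    UniqueIndecomposable k Ω (Finsupp.single x 1) := by
  classical
  constructor
  · let M : QuiverRep k Ω :=
      { V := fun z => Fin (if z = x then 1 else 0) → k
        map := fun _ => 0 }
    have hd : M.HasDimVector (Finsupp.single x 1) := fun z =>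
      ⟨inferInstanceAs (Module.Finite k (Fin _ → k)), by
        change (Module.finrank k (Fin _ → k) : ℤ) = _
        rw [Module.finrank_fin_fun, Finsupp.single_apply]
        simp [eq_comm]⟩
    have h1 : Module.finrank k (M.V x) = 1 := by
      have := (hd x).2
      simpa using this
    have h0 : ∀ z, z ≠ x → Subsingleton (M.V z) := fun z hz =>
      hd.subsingleton_iff.2 (Finsupp.single_eq_of_ne hz)
    have hbot : ∀ A : SubRep M, A.space x = ⊥ → ∀ z, A.space z = ⊥ := by
      intro A hA z
      by_cases hz : z = x
      · rw [hz, hA]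
      · have := h0 z hz
        exact eq_bot_of_subsingleton _
    refine ⟨M, ⟨⟨x, Module.nontrivial_of_finrank_pos (R := k) (by omega)⟩, fun A B h => ?_⟩, hd⟩
    exact (eq_bot_and_eq_top_or_of_isCompl h1 _ _ (h x)).imp (fun h => hbot A h.1) (fun h => hbot B h.1)
  · rintro M N ⟨_, hM⟩ ⟨_, hN⟩
    refine ⟨⟨fun z => (hM.nonempty_equiv hN rfl).some, fun {a b} h w => ?_⟩⟩
    have : Subsingleton (M.V a) := hM.subsingleton_iff.2
      (Finsupp.single_eq_of_ne fun h' => hx b (h' ▸ h))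
    rw [Subsingleton.elim w 0]
    simp

variable [G.LocallyFinite]

theorem surjective_tmap (M : QuiverRep k Ω) {b c : T} (hc : G.Adj b c)
    (hs : Function.Surjective (M.inn b)) (h0 : ∀ a, G.Adj b a → a ≠ c → Subsingleton (M.V a)) :
    Function.Surjective (M.tmap c b) := by
  intro v
  obtain ⟨f, rfl⟩ := hs v
  refine ⟨f ⟨c, hc⟩, ?_⟩
  rw [inn_apply, Finset.sum_eq_single ⟨c, hc⟩]
  · intro a _ ha
    have := h0 a a.2 fun h => ha (Subtype.ext h)
    rw [Subsingleton.elim (f a) 0, map_zero]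
  · simp

theorem bijective_of_finrank_eq_one {V W : Type*} [AddCommGroup V] [Module k V] [AddCommGroup W]
    [Module k W] (hV : Module.finrank k V = 1) (hW : Module.finrank k W = 1) (f : V →ₗ[k] W)
    (hf : Function.Surjective f) : Function.Bijective f := by
  have := Module.finite_of_finrank_pos (R := k) (M := V) (by omega)
  have := Module.finite_of_finrank_pos (R := k) (M := W) (by omega)
  exact ⟨(LinearMap.injective_iff_surjective_of_finrank_eq_finrank (hV.trans hW.symm)).2 hf, hf⟩

/-- Indecomposability makes the incoming map at the sink x surjective. Only the line at y
contributes to it, so the arrow y → x is a bijection of lines, and any identification at y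
determines the one at x. -/
theorem uniqueIndecomposable_single_add_single (hΩ : Ω.IsBipartite) {x y : T} (hx : Ω.IsSink x)
    (hxy : G.Adj x y) : UniqueIndecomposable k Ω (Finsupp.single x 1 + Finsupp.single y 1) := by
  classical
  set d : T →₀ ℤ := Finsupp.single x 1 + Finsupp.single y 1 with hd_def
  have hy : Ω.IsSource y := hΩ.isSource_of_adj hx hxy
  have harrow : Ω.arrow y x := hx.arrow hxy
  have hdx : d x = 1 := by simp [hd_def, hxy.ne]
  have hdy : d y = 1 := by simp [hd_def, hxy.ne']
  have hd0 : ∀ z, z ≠ x → z ≠ y → d z = 0 := by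
    intro z h1 h2
    simp [hd_def, h1, h2]
  have rank : ∀ {M : QuiverRep k Ω}, M.HasDimVector d →
      Module.finrank k (M.V x) = 1 ∧ Module.finrank k (M.V y) = 1 := by
    intro M hM
    have h1 := (hM x).2
    have h2 := (hM y).2
    omega
  constructor
  · let M : QuiverRep k Ω :=
      { V := fun z => Fin (if z = x ∨ z = y then 1 else 0) → k
        -- Summing coordinates makes sense for all dimensions; on the arrow y → x it is the identity
        -- of k, and every other arrow meets a zero space.
        map := fun _ => LinearMap.pi fun _ => ∑ i, LinearMap.proj i }
    have hd : M.HasDimVector d := fun z =>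
      ⟨inferInstanceAs (Module.Finite k (Fin _ → k)), by
        change (Module.finrank k (Fin _ → k) : ℤ) = _
        rw [Module.finrank_fin_fun]
        split_ifs with h
        · rcases h with rfl | rfl
          · rw [hdx]; rfl
          · rw [hdy]; rfl
        · rw [not_or] at h
          rw [hd0 z h.1 h.2]; rfl⟩
    have h0 : ∀ z, z ≠ x → z ≠ y → Subsingleton (M.V z) := fun z h1 h2 =>
      hd.subsingleton_iff.2 (hd0 z h1 h2)
    obtain ⟨hMx, hMy⟩ := rank hd
    have hsurj : Function.Surjective (M.map harrow) := by
      intro v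
      have key : ∀ (m n : ℕ), m = 1 → n = 1 → Function.Surjective
          (LinearMap.pi fun _ : Fin n => ∑ i : Fin m, LinearMap.proj (R := k) (φ := fun _ => k) i)
          := by
        rintro m n rfl rfl v
        refine ⟨v, ?_⟩
        ext i
        rw [Subsingleton.elim i 0]
        simp
      exact key _ _ (by simp) (by simp) v
    have hbot : ∀ A B : SubRep M, (∀ z, IsCompl (A.space z) (B.space z)) → A.space y = ⊥ →
        B.space y = ⊤ → ∀ z, A.space z = ⊥ := by
      intro A B h hA hB z
      by_cases h1 : z = x
      · subst h1
        have : B.space z = ⊤ := by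
          refine eq_top_iff.2 fun v _ => ?_
          obtain ⟨w, rfl⟩ := hsurj v
          exact B.map_mem harrow w (hB ▸ Submodule.mem_top)
        simpa [this] using (h z).inf_eq_bot
      · by_cases h2 : z = y
        · rw [h2, hA]
        · have := h0 z h1 h2
          exact eq_bot_of_subsingleton _
    refine ⟨M, ⟨⟨x, Module.nontrivial_of_finrank_pos (R := k) (by omega)⟩, fun A B h => ?_⟩, hd⟩
    exact (eq_bot_and_eq_top_or_of_isCompl hMy _ _ (h y)).imp (fun h' => hbot A B h h'.1 h'.2)
      (fun h' => hbot B A (fun z => (h z).symm) h'.1 h'.2)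
  · rintro M N ⟨hMi, hM⟩ ⟨hNi, hN⟩
    have bij : ∀ {M : QuiverRep k Ω}, M.IsIndecomposable → M.HasDimVector d →
        Function.Bijective (M.map harrow) := by
      intro M hMi hM
      refine bijective_of_finrank_eq_one (rank hM).2 (rank hM).1 _ ?_
      rw [← tmap_of_arrow]
      refine M.surjective_tmap hxy (hM.surjective_inn hMi (a := y) (by rw [hdy]; simp)
        hxy.ne' hx) fun a ha hay => hM.subsingleton_iff.2 (hd0 a ha.ne' hay)
    let e : ∀ z, M.V z ≃ₗ[k] N.V z := fun z => (hM.nonempty_equiv hN rfl).some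
    let ex : M.V x ≃ₗ[k] N.V x := (LinearEquiv.ofBijective _ (bij hMi hM)).symm ≪≫ₗ e y ≪≫ₗ
      LinearEquiv.ofBijective _ (bij hNi hN)
    refine ⟨⟨Function.update e x ex, fun {a b} h w => ?_⟩⟩
    have hax : a ≠ x := fun h' => hx b (h' ▸ h)
    by_cases hay : a = y
    · subst hay
      by_cases hbx : b = x
      · subst hbx
        rw [Function.update_self, Function.update_of_ne hax]
        have : (LinearEquiv.ofBijective _ (bij hMi hM)).symm (M.map h w) = w := by
          rw [LinearEquiv.symm_apply_eq]; rfl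
        simp only [ex, LinearEquiv.trans_apply, this]
        rfl
      · have : Subsingleton (N.V b) := hN.subsingleton_iff.2
          (hd0 b hbx (GraphOrientation.adj_of_arrow h).ne')
        exact Subsingleton.elim _ _
    · have : Subsingleton (M.V a) := hM.subsingleton_iff.2 (hd0 a hax hay)
      rw [Subsingleton.elim w 0]
      simp

/-- For uniqueness, both candidates are reflected back to indecomposables of dimension vector d; an
isomorphism between those induces one between the reflections. -/
theorem UniqueIndecomposable.reflectSources (hreg : G.IsRegularOfDegree 3) (hΩ : Ω.IsBipartite)
    {d : T →₀ ℤ} (hd : ∃ a, Ω.IsSink a ∧ d a ≠ 0) (h : UniqueIndecomposable k Ω d) :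
    UniqueIndecomposable k Ω.op (Ω.reflectSources d) := by
  constructor
  · obtain ⟨M, hM, hMd⟩ := h.1
    obtain ⟨N, _, hN⟩ := exists_reflection hreg hΩ hd hM hMd
    exact ⟨N, hN⟩
  · rintro N N' ⟨hN, hNd⟩ ⟨hN', hNd'⟩
    obtain ⟨M, ⟨P⟩, hM⟩ := exists_reflection_eq hreg hΩ hd hN hNd
    obtain ⟨M', ⟨P'⟩, hM'⟩ := exists_reflection_eq hreg hΩ hd hN' hNd'
    obtain ⟨f⟩ := h.2 M M' hM hM'
    exact P.nonempty_iso hreg hΩ P' f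

theorem uniqueIndecomposable_sVec (hG : G.Connected) (hreg : G.IsRegularOfDegree 3) {x : T}
    {t : ℕ} (h : Ω.IsOmega x t) : UniqueIndecomposable k Ω (sVec G x t) := by
  induction t generalizing Ω with
  | zero => exact uniqueIndecomposable_single (h.2.1 Even.zero)
  | succ t ih =>
    obtain ⟨Ω, rfl⟩ : ∃ Ω₀ : GraphOrientation G, Ω = Ω₀.op := ⟨Ω.op, rfl⟩
    have h' : Ω.IsOmega x t := h.op
    rw [h'.sVec_succ hG hreg]
    exact (ih h').reflectSources hreg h'.1 (exists_isSink_sVec_ne_zero hG hreg h')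

theorem uniqueIndecomposable_rVec (hG : G.Connected) (hreg : G.IsRegularOfDegree 3) {x y : T}
    (hxy : G.Adj x y) {t : ℕ} (h : Ω.IsOmega x t) :
    UniqueIndecomposable k Ω (rVec G x y t) := by
  induction t generalizing Ω with
  | zero => exact uniqueIndecomposable_single_add_single h.1 (h.2.1 Even.zero) hxy
  | succ t ih =>
    obtain ⟨Ω, rfl⟩ : ∃ Ω₀ : GraphOrientation G, Ω = Ω₀.op := ⟨Ω.op, rfl⟩
    have h' : Ω.IsOmega x t := h.op
    rw [h'.rVec_succ hG hreg]
    exact (ih h').reflectSources hreg h'.1 (exists_isSink_rVec_ne_zero hG hreg hxy h')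

end QuiverRep

/-! ### The exact sequences relating the modules P and R. -/

variable {k : Type u} [Field k] {T : Type v} {G : SimpleGraph T} [G.LocallyFinite]
  {Ω : GraphOrientation G}

theorem GraphOrientation.IsOmega.sVec_one (hG : G.Connected) (hreg : G.IsRegularOfDegree 3)
    {x : T} (h : Ω.IsOmega x 0) :
    sVec G x 1 = Finsupp.single x 1 + ∑ b ∈ G.neighborFinset x, Finsupp.single b 1 := by
  rw [h.sVec_succ hG hreg, sVec, Ω.reflectSources_single_of_isSink h.1 hreg (h.2.1 Even.zero)]

/-- Reflecting s(x) + s(y) gives s_1(x) - s(y), because y is a source. -/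
theorem GraphOrientation.IsOmega.sVec_one_eq_add (hG : G.Connected)
    (hreg : G.IsRegularOfDegree 3) {x y : T} (hxy : G.Adj x y) (h : Ω.IsOmega x 0) :
    sVec G x 1 = Finsupp.single y 1 + rVec G x y 1 := by
  have hx := h.2.1 Even.zero
  rw [h.rVec_succ hG hreg, h.sVec_succ hG hreg, sVec, rVec, Ω.reflectSources_add,
    Ω.reflectSources_single_of_isSource h.1 hreg (h.1.isSource_of_adj hx hxy), Finsupp.single_neg]
  abel

namespace QuiverRep

/-- M has a line at the source x and at each of its three neighbours, A is the simple module at y,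
and C is like M but without the line at y. An identification of M with C at x extends to a
surjection, and A is its kernel. -/
theorem shortExact_zero (hG : G.Connected) (hreg : G.IsRegularOfDegree 3) {x y : T}
    (hxy : G.Adj x y) (hΩ : Ω.IsOmega x 1) {A M C : QuiverRep k Ω} (hA : A.IsP 0 y)
    (hM : M.IsP 1 x) (hC : C.IsR 1 x y) : ShortExact A M C := by
  classical
  obtain ⟨-, -, hA⟩ := hA
  obtain ⟨-, hMi, hM⟩ := hM
  obtain ⟨-, -, hCi, hC⟩ := hC
  have hop : Ω.op.IsOmega x 0 := hΩ.op
  have hx : Ω.IsSource x := hΩ.2.2 odd_one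
  have hy : Ω.IsSink y := hΩ.1.isSink_of_adj hx hxy
  have hs := hop.sVec_one hG hreg
  have hadd : ∀ z, sVec G x 1 z = (Finsupp.single y 1 : T →₀ ℤ) z + rVec G x y 1 z := by
    intro z
    rw [hop.sVec_one_eq_add hG hreg hxy, Finsupp.add_apply]
  have hsz : ∀ z, sVec G x 1 z = (if z = x then 1 else 0) + if G.Adj x z then 1 else 0 := by
    intro z
    rw [hs, Finsupp.add_apply, Finsupp.finsetSum_apply]
    congr 1
    · simp [Finsupp.single_apply, eq_comm]
    · simp [Finsupp.single_apply]
  have hsx : sVec G x 1 x = 1 := by simp [hsz]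
  have hsadj : ∀ z, G.Adj x z → sVec G x 1 z = 1 := fun z hz => by simp [hsz, hz, hz.ne']
  have hs0 : ∀ z, z ≠ x → ¬ G.Adj x z → sVec G x 1 z = 0 := fun z h1 h2 => by simp [hsz, h1, h2]
  have hr : ∀ z, z ≠ y → rVec G x y 1 z = sVec G x 1 z := by
    intro z hz
    rw [hadd, Finsupp.single_eq_of_ne hz, zero_add]
  have hry : rVec G x y 1 y = 0 := by
    have := hadd y
    rw [hsadj y hxy, Finsupp.single_eq_same] at this
    omega
  have hrx : rVec G x y 1 x = 1 := by rw [hr x hxy.ne, hsx]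
  have hCy : Subsingleton (C.V y) := hC.subsingleton_iff.2 hry
  have hsource : ∀ z, Ω.IsSource z → z ≠ x → sVec G x 1 z = 0 := fun z hz hzx =>
    hs0 z hzx fun h => (hΩ.1.isSink_of_adj hx h).not_isSource hreg hz
  have hM0 : ∀ z, Ω.IsSource z → z ≠ x → Subsingleton (M.V z) := fun z hz hzx =>
    hM.subsingleton_iff.2 (hsource z hz hzx)
  have hC0 : ∀ z, Ω.IsSource z → z ≠ x → Subsingleton (C.V z) := fun z hz hzx => by
    rw [hC.subsingleton_iff, hr z fun h => hy.not_isSource hreg (h ▸ hz)]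
    exact hsource z hz hzx
  have hA0 : ∀ z, z ≠ y → Subsingleton (A.V z) := fun z hz =>
    hA.subsingleton_iff.2 (Finsupp.single_eq_of_ne hz)
  have hMsurj : ∀ z, G.Adj x z → Function.Surjective (M.tmap x z) := by
    intro z hz
    have hz' := hΩ.1.isSink_of_adj hx hz
    exact M.surjective_tmap hz.symm (hM.surjective_inn hMi (a := x) (by rw [hsx]; simp) hz.ne hz')
      fun a ha hax => hM0 a (hΩ.1.isSource_of_adj hz' ha) hax
  have hCsurj : ∀ z, G.Adj x z → Function.Surjective (C.tmap x z) := by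
    intro z hz
    have hz' := hΩ.1.isSink_of_adj hx hz
    exact C.surjective_tmap hz.symm (hC.surjective_inn hCi (a := x) (by rw [hrx]; simp) hz.ne hz')
      fun a ha hax => hC0 a (hΩ.1.isSource_of_adj hz' ha) hax
  obtain ⟨θ⟩ : Nonempty (M.V x ≃ₗ[k] C.V x) := hM.nonempty_equiv hC (hsx.trans hrx.symm)
  obtain ⟨φ⟩ : Nonempty (A.V y ≃ₗ[k] M.V y) := hA.nonempty_equiv hM (by
    rw [hsadj y hxy, sVec, Finsupp.single_eq_same])
  -- At a neighbour z the map is forced by θ, since M_x → M_z is a bijection of lines.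
  have hg : ∀ z, ∃ g : M.V z →ₗ[k] C.V z, G.Adj x z →
      ∀ w, g (M.tmap x z w) = C.tmap x z (θ w) := by
    intro z
    by_cases hz : G.Adj x z
    · have hinj : Function.Injective (M.tmap x z) := by
        refine (bijective_of_finrank_eq_one ?_ ?_ _ (hMsurj z hz)).1
        · have := (hM x).2
          omega
        · have := (hM z).2
          have := hsadj z hz
          omega
      obtain ⟨g, hg⟩ := exists_linearMap_comp_eq (M.tmap x z) (hMsurj z hz)
        (C.tmap x z ∘ₗ θ.toLinearMap) fun w hw => by
          rw [hinj (hw.trans (map_zero _).symm), map_zero]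
      exact ⟨g, fun _ => hg⟩
    · exact ⟨0, fun h => absurd h hz⟩
  choose g hg using hg
  let f : Hom A M :=
    { app := Function.update (fun _ => 0) y φ.toLinearMap
      comm := fun {a b} h w => by
        have := hA0 a fun h' => hy b (h' ▸ h)
        rw [Subsingleton.elim w 0]
        simp }
  let p : Hom M C :=
    { app := Function.update g x θ.toLinearMap
      comm := fun {a b} h w => by
        have hbx : b ≠ x := fun h' => hx a (h' ▸ h)
        by_cases hax : a = x
        · subst hax
          rw [Function.update_of_ne hbx, Function.update_self, ← tmap_of_arrow M h,
            hg b (GraphOrientation.adj_of_arrow h), tmap_of_arrow C h]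
          rfl
        · have := hM0 a (hΩ.1.isSource h) hax
          rw [Subsingleton.elim w 0]
          simp }
  have hf : ∀ z, Function.Injective (f.app z) := by
    intro z
    by_cases hz : z = y
    · subst hz
      simpa [f] using φ.injective
    · have := hA0 z hz
      exact Function.injective_of_subsingleton _
  have hp : ∀ z, Function.Surjective (p.app z) := by
    intro z
    by_cases hz : z = x
    · subst hz
      simpa [p] using θ.surjective
    · by_cases hxz : G.Adj x z
      · intro v
        obtain ⟨c, rfl⟩ := hCsurj z hxz v
        obtain ⟨w, rfl⟩ := θ.surjective c
        refine ⟨M.tmap x z w, ?_⟩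
        simp only [p, Function.update_of_ne hz]
        exact hg z hxz w
      · have : Subsingleton (C.V z) := by
          rw [hC.subsingleton_iff, hr z fun h => hxz (h ▸ hxy), hs0 z hz hxz]
        exact Function.surjective_to_subsingleton _
  refine ⟨f, p, hf, hp, fun z => LinearMap.exact_iff.2 ?_⟩
  -- Only this inclusion needs an argument; equality then follows from the additivity of dimensions
  -- `hadd`.
  have hle : LinearMap.range (f.app z) ≤ LinearMap.ker (p.app z) := by
    rintro _ ⟨w, rfl⟩
    by_cases hz : z = y
    · subst hz
      exact Subsingleton.elim _ _
    · have := hA0 z hz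
      rw [Subsingleton.elim w 0, map_zero]
      exact zero_mem _
  have := (hM z).1
  refine (Submodule.eq_of_le_of_finrank_eq hle ?_).symm
  have h1 := (p.app z).finrank_range_add_finrank_ker
  rw [LinearMap.range_eq_top.2 (hp z), finrank_top] at h1
  rw [LinearMap.finrank_range_of_inj (hf z)]
  have h2 := (hM z).2
  have h3 := (hA z).2
  have h4 := (hC z).2
  have h5 := hadd z
  rw [sVec] at h3
  omega

/-- The short exact sequence `0 → P_t(y) → P_{t+1}(x) → R_{t+1}(x,y) → 0`. -/
theorem shortExact_isP_isP_isR (hG : G.Connected) (hreg : G.IsRegularOfDegree 3) {x y : T}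
    (hxy : G.Adj x y) {t : ℕ} {A M C : QuiverRep k Ω} (hA : A.IsP t y)
    (hM : M.IsP (t + 1) x) (hC : C.IsR (t + 1) x y) : ShortExact A M C := by
  induction t generalizing Ω with
  | zero => exact shortExact_zero hG hreg hxy hM.1 hA hM hC
  | succ t ih =>
    obtain ⟨Ω, rfl⟩ : ∃ Ω₀ : GraphOrientation G, Ω = Ω₀.op := ⟨Ω.op, rfl⟩
    have hx : Ω.IsOmega x (t + 1) := hM.1.op
    have hy : Ω.IsOmega y t := hA.1.op
    obtain ⟨-, hAi, hA⟩ := hA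
    obtain ⟨-, hMi, hM⟩ := hM
    obtain ⟨-, -, hCi, hC⟩ := hC
    rw [hy.sVec_succ hG hreg] at hA
    rw [hx.sVec_succ hG hreg] at hM
    rw [hx.rVec_succ hG hreg] at hC
    -- All three modules are reflections of indecomposables whose index is lower by one, and these
    -- satisfy the induction hypothesis.
    obtain ⟨A', ⟨PA⟩, hA'⟩ := exists_reflection_eq hreg hx.1
      (exists_isSink_sVec_ne_zero hG hreg hy) hAi hA
    obtain ⟨M', ⟨PM⟩, hM'⟩ := exists_reflection_eq hreg hx.1
      (exists_isSink_sVec_ne_zero hG hreg hx) hMi hM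
    obtain ⟨C', ⟨PC⟩, hC'⟩ := exists_reflection_eq hreg hx.1
      (exists_isSink_rVec_ne_zero hG hreg hxy hx) hCi hC
    exact PA.shortExact hreg hx.1 PM PC (ih ⟨hy, hA'⟩ ⟨hx, hM'⟩ ⟨hx, hxy, hC'⟩)

theorem IsP.sourceDim (hG : G.Connected) (hreg : G.IsRegularOfDegree 3) {M : QuiverRep k Ω}
    {t : ℕ} {x : T} (h : M.IsP t x) : M.sourceDim = Nat.fib (2 * t) := by
  have := h.2.2.sourceDim_eq
  rw [(weight_sVec hG hreg h.1).1] at this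
  exact_mod_cast this

/-- Index 0 is left out: there the source dimension is 1, while truncated subtraction in `2 * 0 - 1`
would give the Fibonacci number 0. -/
theorem IsR.sourceDim (hG : G.Connected) (hreg : G.IsRegularOfDegree 3) {M : QuiverRep k Ω}
    {t : ℕ} {x y : T} (h : M.IsR (t + 1) x y) :
    M.sourceDim = Nat.fib (2 * (t + 1) - 1) := by
  have := h.2.2.2.sourceDim_eq
  rw [(weight_rVec hG hreg h.2.1 h.1).1] at this
  have f : Nat.fib (2 * (t + 1) + 1) = Nat.fib (2 * (t + 1) - 1) + Nat.fib (2 * (t + 1)) :=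
    Nat.fib_add_two (n := 2 * t + 1)
  omega

end QuiverRep

/-! ### The Fibonacci sum and the conclusion. -/

theorem fib_two_mul_eq_sum (t : ℕ) :
    Nat.fib (2 * t) = ∑ i ∈ Finset.Icc 1 t, Nat.fib (2 * i - 1) := by
  induction t with
  | zero => simp
  | succ t ih =>
    rw [Finset.sum_Icc_succ_top (by omega), ← ih]
    exact Nat.fib_add_two (n := 2 * t)

end FibQuiver

theorem corollary4p2 {k : Type*} [Field k] {T : Type*} (G : SimpleGraph T) [G.LocallyFinite]
    (hG : G.IsTree) (hreg : G.IsRegularOfDegree 3)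
    (Ω : FibQuiver.GraphOrientation G) (hΩ : Ω.IsBipartite)
    (t : ℕ) (x : ℕ → T) (hx : FibQuiver.IsPath G t x) (h0 : Ω.IsSink (x 0)) :
    -- the modules `P_i(x_i)` and `R_{i+1}(x_{i+1}, x_i)` exist and are unique up to isomorphism
    (∀ i, i ≤ t → FibQuiver.QuiverRep.ExistsUniqueUpToIso
      (fun M : FibQuiver.QuiverRep k Ω => M.IsP i (x i))) ∧
    (∀ i, i < t → FibQuiver.QuiverRep.ExistsUniqueUpToIso
      (fun M : FibQuiver.QuiverRep k Ω => M.IsR (i + 1) (x (i + 1)) (x i))) ∧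
    -- the filtration
    (∀ P R : ℕ → FibQuiver.QuiverRep k Ω,
      (∀ i, i ≤ t → (P i).IsP i (x i)) →
      (∀ i, i < t → (R (i + 1)).IsR (i + 1) (x (i + 1)) (x i)) →
      (∃ F : ℕ → FibQuiver.QuiverRep.SubRep (P t),
        (∀ i, i ≤ t → Nonempty (FibQuiver.QuiverRep.Iso (F i).toRep (P i))) ∧
        (∀ z, (F t).space z = ⊤) ∧
        (∀ i, i < t → ∀ z, (F i).space z ≤ (F (i + 1)).space z) ∧
        (∀ i, i < t → Nonempty
          (FibQuiver.QuiverRep.Iso ((F i).factor (F (i + 1))) (R (i + 1))))) ∧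
      -- the Fibonacci numbers are the total dimensions at the sources
      (∀ i, i ≤ t → (P i).sourceDim = Nat.fib (2 * i)) ∧
      (∀ i, i < t → (R (i + 1)).sourceDim = Nat.fib (2 * (i + 1) - 1)) ∧
      (P t).sourceDim = ∑ i ∈ Finset.Icc 1 t, (R i).sourceDim) ∧
    Nat.fib (2 * t) = ∑ i ∈ Finset.Icc 1 t, Nat.fib (2 * i - 1) := by
  -- Sinks and sources alternate along the path, starting from the sink x_0.
  have hpar : ∀ i, i ≤ t → Ω.IsOmega (x i) i := by
    intro i
    induction i with
    | zero => exact fun _ => ⟨hΩ, fun _ => h0, fun h => absurd h (by decide)⟩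
    | succ i ih => exact fun hi => (ih (by omega)).succ_of_adj (hx.1 i hi)
  have hadj : ∀ i, i < t → G.Adj (x (i + 1)) (x i) := fun i hi => (hx.1 i hi).symm
  have hconn := hG.connected
  refine ⟨fun i hi => ?_, fun i hi => ?_, fun P R hP hR => ⟨?_, ?_, ?_, ?_⟩,
    FibQuiver.fib_two_mul_eq_sum t⟩
  · obtain ⟨⟨M, hM⟩, h⟩ :=
      FibQuiver.QuiverRep.uniqueIndecomposable_sVec (k := k) hconn hreg (hpar i hi)
    exact ⟨⟨M, hpar i hi, hM⟩, fun M N hM hN => h M N hM.2 hN.2⟩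
  · obtain ⟨⟨M, hM⟩, h⟩ :=
      FibQuiver.QuiverRep.uniqueIndecomposable_rVec (k := k) hconn hreg (hadj i hi)
        (hpar (i + 1) hi)
    exact ⟨⟨M, hpar (i + 1) hi, hadj i hi, hM⟩, fun M N hM hN => h M N hM.2.2 hN.2.2⟩
  · exact FibQuiver.QuiverRep.exists_filtration P R t fun i hi =>
      FibQuiver.QuiverRep.shortExact_isP_isP_isR hconn hreg (hadj i hi) (hP i hi.le)
        (hP (i + 1) hi) (hR i hi)
  · exact fun i hi => (hP i hi).sourceDim hconn hreg
  · exact fun i hi => (hR i hi).sourceDim hconn hreg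
  · rw [(hP t le_rfl).sourceDim hconn hreg, FibQuiver.fib_two_mul_eq_sum]
    refine Finset.sum_congr rfl fun i hi => ?_
    obtain ⟨h1, h2⟩ := Finset.mem_Icc.1 hi
    obtain ⟨j, rfl⟩ : ∃ j, i = j + 1 := ⟨i - 1, by omega⟩
    exact ((hR j h2).sourceDim hconn hreg).symm
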